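/- **Setting.** A target (detector) consists of $N$ sites, $\mathcal H=\bigotimes_{k=1}^N\mathcal H_k$ with each $\mathcal H_k$ a finite-dimensional Hilbert space, and is initially in a density matrix $\rho^{(0)}$. Particles $\ell=1,\dots,K$ scatter from it one after the other. Particle $\ell$ has a finite-dimensional state space $\mathcal P_\ell$ with an orthonormal basis $\{|f\rangle\}$ containing its incident state $|i_\ell\rangle$. The total S-matrix is $S=S_K\cdots S_1$, where $S_\ell=S_\ell(\alpha)$ is unitary on $\mathcal P_\ell\otimes\mathcal H$ and $$S_\ell(\alpha)=1+i\alpha\sum_{k=1}^N T_{\ell,k}+O(\alpha^2)\qquad(\alpha\to0^+),$$ with $T_{\ell,k}$ acting only on $\mathcal P_\ell\otimes\mathcal H_k$. The state of the target after $\ell$ particles is $$\rho^{(\ell)}=\mathrm{Tr}_{\mathcal P_\ell}\big[S_\ell(\alpha)\,(|i_\ell\rangle\langle i_\ell|\otimes\rho^{(\ell-1)})\,S_\ell(\alpha)^\dagger\big],$$ and in the absence of particles it stays $\rho^{(0)}$ (interaction picture). For a pure state $\psi$ of the target let $s_k(\psi)$ be the von Neumann entropy of the reduced state of $\psi$ on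 $\mathcal H_k$. Let $$E_{\rm MF}(\rho)=\min_{\rho=\sum_j p_j|\psi_j\rangle\langle\psi_j|}\ \sum_j p_j\,\frac1N\sum_{k=1}^N s_k(\psi_j),\qquad E_{\rm MF}^{\max}=\max_{0\le\ell\le K}E_{\rm MF}(\rho^{(\ell)}).$$ For a pure target state $t$ let $p_\perp^{i\to i}=\big\|(1-|t\rangle\langle t|)\,\langle i_\ell|S_\ell|i_\ell\rangle\,|t\rangle\big\|^2$. **Detection.** Fix a type I error $\epsilon$ and a power $\pi>\epsilon$. For an effect $0\le E\le1$ (the positive outcome of a measurement of the target), the power is $$\mathrm{Tr}[E\rho^{(K)}]=\mathrm{Tr}[E\rho^{(0)}]+\sum_{\ell=1}^K g_\ell,\qquad g_\ell=\mathrm{Tr}[E\rho^{(\ell)}]-\mathrm{Tr}[E\rho^{(\ell-1)}].$$ A value $\alpha>0$ is *detectable at order $\alpha^n$* if for some effect $E$ one has $\mathrm{Tr}[E\rho^{(0)}]\le\epsilon$ and the power is at least $\pi$ when each $g_\ell$ is replaced by its expansion to order $n$ in the expansion parameter of the $\ell$-th scattering. That is, the state $\rho^{(\ell-1)}$ that the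 $\ell$-th particle meets is held fixed at its actual value, $\mathrm{Tr}\big[E\,\mathrm{Tr}_{\mathcal P_\ell}[S_\ell(\beta)(|i_\ell\rangle\langle i_\ell|\otimes\rho^{(\ell-1)})S_\ell(\beta)^\dagger]\big]-\mathrm{Tr}[E\rho^{(\ell-1)}]=q_\ell(\beta)+O(\beta^{n+1})$ as $\beta\to0^+$ with $q_\ell$ a real polynomial of degree at most $n$, and $g_\ell$ is replaced by $q_\ell(\alpha)$. The detection limit $\alpha_{\min}$ at that order is the smallest detectable $\alpha$. **Theorem.** Let $B\in\mathbb R$ and $\pi>\epsilon$. There is a constant $C$, depending only on $B,\pi,\epsilon$, such that the following holds for all $N$ and $K$ and all processes as above for which the orthogonal scattering probability from each site alone is at most $B\alpha^2$ at order $\alpha^2$, i.e. $$\sum_f\big\|(1-|\varphi\rangle\langle\varphi|)\langle f|T_{\ell,k}|i_\ell\rangle\varphi\big\|^2\le B\quad\text{for all }\ell,k\text{ and all unit vectors }\varphi\in\mathcal H_k .$$ 1. Every $\alpha>0$ that is detectable at order $\alpha$ (in particular $\alpha_{\min}$) satisfies $$\frac1{\alpha^2}\le C\Big(K^2N+K^2N^2\sqrt{E_{\rm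 MF}^{\max}}\Big).$$ 2. Let $\alpha>0$ be such that fully forward elastic scattering does not affect the target: for each $\ell$ the state $\rho^{(\ell-1)}$ has a decomposition into pure states that realizes $E_{\rm MF}(\rho^{(\ell-1)})$ and all of whose components have $p_\perp^{i\to i}=0$, where $p_\perp^{i\to i}$ is computed with $S_\ell(\beta)$ for all small $\beta>0$ (it is enough that $p_\perp^{i\to i}=O(\beta^6)$, i.e. $\sqrt{p_\perp^{i\to i}}=O(\beta^3)$, as $\beta\to0^+$). Then $\alpha$ is not detectable at order $\alpha$. If moreover the probability of scattering from each site alone to another particle state is at most $B\alpha^2$ at order $\alpha^2$, i.e. $\sum_{f\ne i_\ell}\|\langle f|T_{\ell,k}|i_\ell\rangle\varphi\|^2\le B$ for all $\ell,k$ and all unit $\varphi\in\mathcal H_k$, and $\alpha$ is detectable at order $\alpha^2$, then $$\frac1{\alpha^2}\le C\Big(KN^{3/2}+KN^2\big(E_{\rm MF}^{\max}\big)^{1/4}\Big).$$ Here $E_{\rm MF}^{\max}$ is evaluated along the states $\rho^{(\ell)}$ at the same $\alpha$. -/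

import Mathlib

open Filter Topology Asymptotics
open scoped ComplexOrder

noncomputable section

namespace Scattering

/-- Orthonormal product basis of `⨂ k, ℂ ^ (d k)`: one basis label for each of the `N` sites. -/
abbrev Config {N : ℕ} (d : Fin N → ℕ) : Type := ∀ k, Fin (d k)

section States

variable {n : Type} [Fintype n] [DecidableEq n]

/-- `ψ` is a unit vector (with respect to the Euclidean inner product). -/
def IsUnitVec (ψ : n → ℂ) : Prop := star ψ ⬝ᵥ ψ = 1

/-- The rank-one projection (for unit `ψ`) `|ψ⟩⟨ψ|`. -/
def ketbra (ψ : n → ℂ) : Matrix n n ℂ := Matrix.vecMulVec ψ (star ψ)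

/-- `ρ` is a density matrix. -/
def IsDensity (ρ : Matrix n n ℂ) : Prop := ρ.PosSemidef ∧ ρ.trace = 1

/-- `ρ` is the mixture of the pure states `ψ j` with the weights `p j`. -/
def IsMixture {r : ℕ} (ρ : Matrix n n ℂ) (p : Fin r → ℝ) (ψ : Fin r → n → ℂ) : Prop :=
  (∀ j, 0 ≤ p j) ∧ ∑ j, p j = 1 ∧ (∀ j, IsUnitVec (ψ j)) ∧ ρ = ∑ j, (p j : ℂ) • ketbra (ψ j)

/-- Von Neumann entropy `-Tr[ρ ln ρ] = ∑ -λ ln λ`, over the eigenvalues `λ` of the Hermitian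
matrix `ρ` with multiplicity (with value `0` for matrices that are not Hermitian). -/
def entropy (ρ : Matrix n n ℂ) : ℝ :=
  open Classical in
  if h : ρ.IsHermitian then ∑ j, Real.negMulLog (h.eigenvalues j) else 0

/-- `E` is an effect: the operator `0 ≤ E ≤ 1` of the positive outcome of a two-outcome POVM. -/
def IsEffect (E : Matrix n n ℂ) : Prop := E.PosSemidef ∧ (1 - E).PosSemidef

/-- Probability `Tr[E ρ]` of the outcome `E` in the state `ρ`. -/
def prob (E ρ : Matrix n n ℂ) : ℝ := ((E * ρ).trace).re

/-- The operator `⟨f| A |i⟩` on the target, for an operator `A` on particle ⊗ target; the particle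
has the orthonormal basis `Fin m`. -/
def block {m : ℕ} (A : Matrix (Fin m × n) (Fin m × n) ℂ) (f i : Fin m) : Matrix n n ℂ :=
  Matrix.of fun x y => A (f, x) (i, y)

/-- State of the target after a particle in the state `i` has scattered with S-matrix `U` and
the outgoing particle has been traced out: `Tr_particle[U (|i⟩⟨i| ⊗ ρ) U†]`, written as
`∑ g, ⟨g|U|i⟩ ρ ⟨g|U|i⟩†`. -/
def scatter {m : ℕ} (U : Matrix (Fin m × n) (Fin m × n) ℂ) (i : Fin m) (ρ : Matrix n n ℂ) :
    Matrix n n ℂ :=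
  ∑ g, block U g i * ρ * (block U g i).conjTranspose

/-- `⟨i|⟨t| A† (|f⟩⟨f| ⊗ (1 - |t⟩⟨t|)) A |i⟩|t⟩`, the orthogonal scattering probability from `i`
to `f` for a pure target state `t` (when `A` is the S-matrix). -/
def perpProb {m : ℕ} (A : Matrix (Fin m × n) (Fin m × n) ℂ) (i f : Fin m) (t : n → ℂ) : ℝ :=
  (star ((block A f i).mulVec t) ⬝ᵥ (1 - ketbra t).mulVec ((block A f i).mulVec t)).re

/-- `⟨i|⟨t| A† ((1 - |i⟩⟨i|) ⊗ 1) A |i⟩|t⟩`, the total probability for a particle in the state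
`i` to leave in a state orthogonal to `i` (when `A` is the S-matrix). -/
def scatProb {m : ℕ} (A : Matrix (Fin m × n) (Fin m × n) ℂ) (i : Fin m) (t : n → ℂ) : ℝ :=
  ∑ f ∈ Finset.univ.erase i,
    (star ((block A f i).mulVec t) ⬝ᵥ (block A f i).mulVec t).re

end States

section Sites

variable {N : ℕ} {d : Fin N → ℕ}

/-- Reduced state of the `k`-th site: the trace of `ρ` over all other sites. -/
def reduced (ρ : Matrix (Config d) (Config d) ℂ) (k : Fin N) :
    Matrix (Fin (d k)) (Fin (d k)) ℂ :=
  Matrix.of fun a b => ∑ x : Config d, if x k = a then ρ x (Function.update x k b) else 0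

/-- Average over the sites of the single-site entropies of the pure state `ψ`. -/
def avgEntropy (ψ : Config d → ℂ) : ℝ := (∑ k, entropy (reduced (ketbra ψ) k)) / N

/-- Weighted mean of `avgEntropy` over a family of pure states. -/
def meanEntropy {r : ℕ} (p : Fin r → ℝ) (ψ : Fin r → Config d → ℂ) : ℝ :=
  ∑ j, p j * avgEntropy (ψ j)

/-- The multipartite entanglement of formation: the minimum (written as an infimum) of
`meanEntropy` over all decompositions of `ρ` into weighted pure states. -/
def EMF (ρ : Matrix (Config d) (Config d) ℂ) : ℝ :=
  sInf {e | ∃ (r : ℕ) (p : Fin r → ℝ) (ψ : Fin r → Config d → ℂ),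
    IsMixture ρ p ψ ∧ e = meanEntropy p ψ}

/-- An operator on particle ⊗ (`k`-th site), extended by the identity on all other sites. -/
def atSite {m : ℕ} (k : Fin N) (A : Matrix (Fin m × Fin (d k)) (Fin m × Fin (d k)) ℂ) :
    Matrix (Fin m × Config d) (Fin m × Config d) ℂ :=
  open Classical in
  Matrix.of fun u v =>
    if ∀ j, j ≠ k → u.2 j = v.2 j then A (u.1, u.2 k) (v.1, v.2 k) else 0

end Sites

/-- `K` independent particles that scatter one after the other from a target with `N` sites.
The `ℓ`-th particle has a finite-dimensional space of states, with an orthonormal basis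
`Fin (m ℓ)` that contains its incident state `i ℓ`. -/
structure Experiment (N K : ℕ) where
  /-- dimensions of the sites -/
  d : Fin N → ℕ
  /-- initial state of the target -/
  ρ₀ : Matrix (Config d) (Config d) ℂ
  isDensity : IsDensity ρ₀
  /-- dimensions of the particles' state spaces -/
  m : Fin K → ℕ
  /-- incident states -/
  i : ∀ ℓ, Fin (m ℓ)
  /-- S-matrix of each particle with the target, as a function of the expansion parameter -/
  S : ∀ ℓ, ℝ → Matrix (Fin (m ℓ) × Config d) (Fin (m ℓ) × Config d) ℂ
  /-- first-order coefficients, each acting on the particle and on a single site -/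
  T : ∀ ℓ k, Matrix (Fin (m ℓ) × Fin (d k)) (Fin (m ℓ) × Fin (d k)) ℂ
  isUnitary : ∀ ℓ α, S ℓ α ∈ Matrix.unitaryGroup (Fin (m ℓ) × Config d) ℂ
  /-- `S = 1 + i α ∑ k, T k + O(α²)` -/
  expansion : ∀ ℓ u v,
    (fun α : ℝ => (S ℓ α - (1 + (Complex.I * α) • ∑ k, atSite k (T ℓ k))) u v)
      =O[𝓝[>] 0] fun α : ℝ => α ^ 2

namespace Experiment

variable {N K : ℕ} (X : Experiment N K)

/-- State of the target after the first `ℓ` particles, `ℓ = 0, …, K`, at the value `α` of the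
expansion parameter. The state without incident particles is `ρ₀` (interaction picture). -/
def state (α : ℝ) : Fin (K + 1) → Matrix (Config X.d) (Config X.d) ℂ :=
  Fin.induction X.ρ₀ fun ℓ σ => scatter (X.S ℓ α) (X.i ℓ) σ

/-- Largest entanglement of formation that the target attains during the experiment. -/
def EMFmax (α : ℝ) : ℝ := ⨆ ℓ, EMF (X.state α ℓ)

/-- The change that the `ℓ`-th particle would make to the probability of the outcome `E`, if it
met the target in the state `σ` and scattered with the expansion parameter `β`. -/
def gain (E σ : Matrix (Config X.d) (Config X.d) ℂ) (ℓ : Fin K) (β : ℝ) : ℝ :=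
  prob E (scatter (X.S ℓ β) (X.i ℓ) σ) - prob E σ

/-- At the value `α` of the expansion parameter, some measurement of the target detects the
presence of the particles with type I error at most `ε` and with power at least `π`, where the
scattering of each particle from the state that it meets is expanded to order `α ^ n`.

The power is `prob E (state α K)`, which is the type I error `prob E ρ₀` plus the sum over `ℓ`
of `gain E (state α (ℓ - 1)) ℓ α`; `q ℓ` is the expansion of the `ℓ`-th summand to order `n` in
the expansion parameter of the `ℓ`-th scattering. -/
def DetectsAtOrder (n : ℕ) (π ε α : ℝ) : Prop :=
  ∃ (E : Matrix (Config X.d) (Config X.d) ℂ) (q : Fin K → Polynomial ℝ),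
    IsEffect E ∧ prob E X.ρ₀ ≤ ε ∧
    (∀ ℓ, (q ℓ).natDegree ≤ n ∧
      (fun β : ℝ => X.gain E (X.state α ℓ.castSucc) ℓ β - (q ℓ).eval β)
        =O[𝓝[>] 0] fun β : ℝ => β ^ (n + 1)) ∧
    π ≤ prob E X.ρ₀ + ∑ ℓ, (q ℓ).eval α

/-- Fully forward elastic scattering does not affect the target: each particle meets the target in
a state that has a decomposition into pure states, realizing its entanglement of formation, for
all components of which `p_⊥` from `i` to `i` vanishes. It is enough that it vanishes up to
`O(β ^ 6)`, so that its square root, which is what bounds the change of the target's state, is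
of third order in the expansion parameter `β` of that scattering. -/
def ForwardInert (α : ℝ) : Prop :=
  ∀ ℓ, ∃ (r : ℕ) (p : Fin r → ℝ) (ψ : Fin r → Config X.d → ℂ),
    IsMixture (X.state α ℓ.castSucc) p ψ ∧ meanEntropy p ψ = EMF (X.state α ℓ.castSucc) ∧
    ∀ j, 0 < p j →
      (fun β : ℝ => perpProb (X.S ℓ β) (X.i ℓ) (X.i ℓ) (ψ j)) =O[𝓝[>] 0] fun β : ℝ => β ^ 6

/-- The order-`α²` orthogonal scattering probability from each single site, in any pure state of
that site and summed over outgoing states, is at most `B α²`. -/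
def PerpBounded (B : ℝ) : Prop :=
  ∀ ℓ k φ, IsUnitVec φ → ∑ f, perpProb (X.T ℓ k) (X.i ℓ) f φ ≤ B

/-- The order-`α²` probability of scattering from each single site to a different particle
state, in any pure state of that site, is at most `B α²`. -/
def ScatBounded (B : ℝ) : Prop :=
  ∀ ℓ k φ, IsUnitVec φ → scatProb (X.T ℓ k) (X.i ℓ) φ ≤ B

end Experiment

end Scattering

end

/-! Let `t` be a pure component of the state that a particle meets, and let `y f` be its image under
`⟨f|S|i⟩`. An effect is `C†C` with a contraction `C`, so its probability can change only through the
parts of the `y f` orthogonal to `t`; the change is at most `scatterBound`. To first order in `β`,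
`y f` is `δ_{fi} t + iβ m f`, where `m f` is the sum over the sites of the operators `⟨f|T k|i⟩`
applied to `t`. Hence the bound is `2‖(m i)⊥‖ β` at first order. If the forward channel's orthogonal
part is `o(β²)`, the bound at second order is a sum over `f ≠ i` of products of first-order
quantities, so the second-order term of `S` never enters.

The core is `sum_norm_sq_orthPart_siteOp_le`: `∑ f, ‖(m f)⊥‖²` is at most a constant times `B (N +
N² √s)`, with `s` the mean single-site entropy of `t`. The left side is a sum of covariances over
pairs of sites. Bounded variances in all pure states of a site force its operators to be of size
`√B` up to scalars, and scalars do not affect covariances, so the diagonal pairs give `N B`. For `k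
≠ l`, project site `k` onto the top eigenvector of its reduced state. In the projected vector site
`k` factors out and the covariance vanishes; the error is governed by `‖t - P k t‖`, whose square is
one minus the top eigenvalue, hence at most the entropy of the site. Cauchy–Schwarz over the sites
produces `N² √s`.

Concavity of the square root carries the estimate over to mixtures, where `EMF` appears, and the
contributions of the `K` particles add. Order `α` gives an amplitude bound that is squared at the
end. At order `α²`, Cauchy–Schwarz over `f ≠ i` pairs the total scattering amplitude, at most `N
√B`, with the orthogonal one. -/

noncomputable section

namespace Scattering

/-! ### Orthogonal parts, variances and covariances in an inner product space -/

section Hilbert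

variable {ι E F : Type*} [Fintype ι] [NormedAddCommGroup E] [InnerProductSpace ℂ E]
  [NormedAddCommGroup F] [InnerProductSpace ℂ F]

/-- The component of `y` orthogonal to the unit vector `t`. -/
def orthPart (t y : E) : E := y - inner ℂ t y • t

lemma inner_orthPart {t : E} (ht : ‖t‖ = 1) (y : E) : inner ℂ t (orthPart t y) = 0 := by
  simp [orthPart, inner_self_eq_norm_sq_to_K, ht]

lemma norm_sq_eq_orthPart {t : E} (ht : ‖t‖ = 1) (y : E) :
    ‖y‖ ^ 2 = ‖inner ℂ t y‖ ^ 2 + ‖orthPart t y‖ ^ 2 := by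
  have h : y = inner ℂ t y • t + orthPart t y := by simp [orthPart]
  have h0 : inner ℂ (inner ℂ t y • t) (orthPart t y) = 0 := by
    rw [inner_smul_left, inner_orthPart ht, mul_zero]
  have := norm_add_sq_eq_norm_sq_add_norm_sq_of_inner_eq_zero _ _ h0
  rw [← h, norm_smul, ht, mul_one] at this
  nlinarith

lemma norm_orthPart_le {t : E} (ht : ‖t‖ = 1) (y : E) : ‖orthPart t y‖ ≤ ‖y‖ := by
  have := norm_sq_eq_orthPart ht y
  exact le_of_sq_le_sq (by nlinarith [sq_nonneg ‖inner ℂ t y‖]) (norm_nonneg _)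

lemma norm_inner_unit_le {t : E} (ht : ‖t‖ = 1) (y : E) : ‖inner ℂ t y‖ ≤ ‖y‖ := by
  simpa [ht] using norm_inner_le_norm (𝕜 := ℂ) t y

lemma orthPart_add (t x y : E) : orthPart t (x + y) = orthPart t x + orthPart t y := by
  simp only [orthPart, inner_add_right, add_smul]; abel

lemma orthPart_smul (t x : E) (c : ℂ) : orthPart t (c • x) = c • orthPart t x := by
  simp only [orthPart, inner_smul_right, smul_sub, mul_smul]

lemma orthPart_self {t : E} (ht : ‖t‖ = 1) : orthPart t t = 0 := by
  simp [orthPart, inner_self_eq_norm_sq_to_K, ht]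

lemma orthPart_sum {κ : Type*} (s : Finset κ) (t : E) (x : κ → E) :
    orthPart t (∑ k ∈ s, x k) = ∑ k ∈ s, orthPart t (x k) := by
  simp only [orthPart, inner_sum, Finset.sum_smul, Finset.sum_sub_distrib]

lemma continuous_orthPart (t : E) : Continuous (orthPart t) := by
  unfold orthPart; fun_prop

lemma norm_add_sq_le_two (x y : E) : ‖x + y‖ ^ 2 ≤ 2 * ‖x‖ ^ 2 + 2 * ‖y‖ ^ 2 := by
  have := norm_add_le x y
  nlinarith [norm_nonneg (x + y), sq_nonneg (‖x‖ - ‖y‖)]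

/-- Cauchy–Schwarz for families of vectors. -/
lemma norm_sum_inner_le {x y : ι → E} {a b : ℝ} (ha : 0 ≤ a) (hb : 0 ≤ b)
    (hx : ∑ f, ‖x f‖ ^ 2 ≤ a ^ 2) (hy : ∑ f, ‖y f‖ ^ 2 ≤ b ^ 2) :
    ‖∑ f, inner ℂ (x f) (y f)‖ ≤ a * b := by
  calc ‖∑ f, inner ℂ (x f) (y f)‖ ≤ ∑ f, ‖x f‖ * ‖y f‖ :=
        (norm_sum_le _ _).trans (Finset.sum_le_sum fun f _ => norm_inner_le_norm _ _)
    _ ≤ √(∑ f, ‖x f‖ ^ 2) * √(∑ f, ‖y f‖ ^ 2) := Real.sum_mul_le_sqrt_mul_sqrt _ _ _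
    _ ≤ a * b := by
        gcongr
        · exact Real.sqrt_le_iff.2 ⟨ha, hx⟩
        · exact Real.sqrt_le_iff.2 ⟨hb, hy⟩

/-- A contraction changes the probability of an outcome only through the orthogonal parts. -/
lemma abs_norm_sq_sub_le (C : E →ₗ[ℂ] F) (hC : ∀ x, ‖C x‖ ≤ ‖x‖) {t : E} (ht : ‖t‖ = 1)
    (y : E) : |‖C y‖ ^ 2 - ‖y‖ ^ 2 * ‖C t‖ ^ 2| ≤
      2 * ‖inner ℂ t y‖ * ‖orthPart t y‖ + ‖orthPart t y‖ ^ 2 := by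
  have h : C y = inner ℂ t y • C t + C (orthPart t y) := by
    rw [← map_smul, ← map_add]; simp [orthPart]
  have h1 := norm_add_sq (𝕜 := ℂ) (inner ℂ t y • C t) (C (orthPart t y))
  rw [← h, norm_smul, mul_pow] at h1
  have hCt : ‖C t‖ ≤ 1 := by simpa [ht] using hC t
  have h2 : |RCLike.re (inner ℂ (inner ℂ t y • C t) (C (orthPart t y)))| ≤
      ‖inner ℂ t y‖ * ‖orthPart t y‖ := by
    refine (RCLike.abs_re_le_norm _).trans ((norm_inner_le_norm _ _).trans ?_)
    rw [norm_smul]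
    have := hC (orthPart t y)
    gcongr
    nlinarith [norm_nonneg (inner ℂ t y)]
  have h3 : ‖C (orthPart t y)‖ ^ 2 ≤ ‖orthPart t y‖ ^ 2 := by gcongr; exact hC _
  have h4 : ‖orthPart t y‖ ^ 2 * ‖C t‖ ^ 2 ≤ ‖orthPart t y‖ ^ 2 :=
    mul_le_of_le_one_right (sq_nonneg _) (pow_le_one₀ (norm_nonneg _) hCt)
  have h5 : 0 ≤ ‖orthPart t y‖ ^ 2 * ‖C t‖ ^ 2 := by positivity
  rw [h1, norm_sq_eq_orthPart ht y]
  rw [abs_le] at h2 ⊢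
  constructor <;> nlinarith [sq_nonneg ‖C (orthPart t y)‖]

lemma abs_sum_norm_sq_sub_le (C : E →ₗ[ℂ] F) (hC : ∀ x, ‖C x‖ ≤ ‖x‖) {t : E} (ht : ‖t‖ = 1)
    (y : ι → E) (hy : ∑ f, ‖y f‖ ^ 2 = 1) : |∑ f, ‖C (y f)‖ ^ 2 - ‖C t‖ ^ 2| ≤
      ∑ f, (2 * ‖inner ℂ t (y f)‖ * ‖orthPart t (y f)‖ + ‖orthPart t (y f)‖ ^ 2) := by
  have : ∑ f, ‖C (y f)‖ ^ 2 - ‖C t‖ ^ 2 = ∑ f, (‖C (y f)‖ ^ 2 - ‖y f‖ ^ 2 * ‖C t‖ ^ 2) := by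
    rw [Finset.sum_sub_distrib, ← Finset.sum_mul, hy, one_mul]
  rw [this]
  exact (Finset.abs_sum_le_sum_abs _ _).trans
    (Finset.sum_le_sum fun f _ => abs_norm_sq_sub_le C hC ht (y f))

section Scalar

variable {A : ι → E →ₗ[ℂ] E} {B : ℝ}

/-- Off-diagonal matrix elements between orthogonal vectors see only the orthogonal part of `A f φ`,
so the variance bound controls them after normalizing `φ`. -/
lemma sum_norm_sq_orthPart_le_of_unit
    (hA : ∀ φ : E, ‖φ‖ = 1 → ∑ f, ‖orthPart φ (A f φ)‖ ^ 2 ≤ B) {χ φ : E}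
    (h : inner ℂ χ φ = 0) : ∑ f, ‖inner ℂ χ (A f φ)‖ ^ 2 ≤ B * ‖χ‖ ^ 2 * ‖φ‖ ^ 2 := by
  rcases eq_or_ne φ 0 with rfl | hφ
  · simp
  have hφ' : ‖φ‖ ≠ 0 := norm_ne_zero_iff.2 hφ
  set u : E := ((‖φ‖ : ℂ))⁻¹ • φ with hu
  have hu1 : ‖u‖ = 1 := by simp [hu, norm_smul, hφ']
  have hφu : φ = (‖φ‖ : ℂ) • u := by
    rw [hu, smul_smul, mul_inv_cancel₀ (by exact_mod_cast hφ'), one_smul]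
  have hχu : inner ℂ χ u = 0 := by rw [hu, inner_smul_right, h, mul_zero]
  have key : ∀ f, ‖inner ℂ χ (A f φ)‖ ^ 2 ≤ ‖χ‖ ^ 2 * ‖φ‖ ^ 2 * ‖orthPart u (A f u)‖ ^ 2 := by
    intro f
    have h1 : inner ℂ χ (A f φ) = (‖φ‖ : ℂ) * inner ℂ χ (orthPart u (A f u)) := by
      conv_lhs => rw [hφu, map_smul, inner_smul_right]
      simp [orthPart, inner_sub_right, inner_smul_right, hχu]
    have h2 := norm_inner_le_norm (𝕜 := ℂ) χ (orthPart u (A f u))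
    rw [h1, norm_mul, mul_pow]
    have h3 : ‖inner ℂ χ (orthPart u (A f u))‖ ^ 2 ≤ (‖χ‖ * ‖orthPart u (A f u)‖) ^ 2 := by
      gcongr
    have : ‖(‖φ‖ : ℂ)‖ = ‖φ‖ := by simp
    rw [this]
    nlinarith [mul_le_mul_of_nonneg_left h3 (sq_nonneg ‖φ‖)]
  calc ∑ f, ‖inner ℂ χ (A f φ)‖ ^ 2 ≤ ∑ f, ‖χ‖ ^ 2 * ‖φ‖ ^ 2 * ‖orthPart u (A f u)‖ ^ 2 :=
        Finset.sum_le_sum fun f _ => key f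
    _ ≤ ‖χ‖ ^ 2 * ‖φ‖ ^ 2 * B := by
        rw [← Finset.mul_sum]
        exact mul_le_mul_of_nonneg_left (hA u hu1) (by positivity)
    _ = _ := by ring

/-- A difference of diagonal elements is a combination of off-diagonal ones: since `u - w ⊥ u + w`,
polarization writes it through `⟨u - w, A (u + w)⟩`, `⟨u, A w⟩` and `⟨w, A u⟩`. The constant is `3 *
(4 + 1 + 1)`. -/
lemma sum_norm_sq_sub_inner_le
    (hA : ∀ φ : E, ‖φ‖ = 1 → ∑ f, ‖orthPart φ (A f φ)‖ ^ 2 ≤ B) {u w : E}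
    (hu : ‖u‖ = 1) (hw : ‖w‖ = 1) (h : inner ℂ u w = 0) :
    ∑ f, ‖inner ℂ w (A f w) - inner ℂ u (A f u)‖ ^ 2 ≤ 18 * B := by
  have h' : inner ℂ w u = 0 := inner_eq_zero_symm.1 h
  have h1 := sum_norm_sq_orthPart_le_of_unit hA h
  have h2 := sum_norm_sq_orthPart_le_of_unit hA h'
  have h3 := sum_norm_sq_orthPart_le_of_unit hA (χ := u - w) (φ := u + w) (by
    simp [inner_sub_left, inner_add_right, h, h', inner_self_eq_norm_sq_to_K, hu, hw])
  have e1 : ‖u - w‖ ^ 2 = 2 := by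
    have := norm_sub_sq (𝕜 := ℂ) u w
    rw [this, h, hu, hw]; norm_num
  have e2 : ‖u + w‖ ^ 2 = 2 := by
    have := norm_add_sq (𝕜 := ℂ) u w
    rw [this, h, hu, hw]; norm_num
  rw [e1, e2] at h3
  rw [hu, hw] at h1 h2
  have key : ∀ f, ‖inner ℂ w (A f w) - inner ℂ u (A f u)‖ ^ 2 ≤
      3 * (‖inner ℂ (u - w) (A f (u + w))‖ ^ 2 + ‖inner ℂ u (A f w)‖ ^ 2 +
        ‖inner ℂ w (A f u)‖ ^ 2) := by
    intro f
    have : inner ℂ w (A f w) - inner ℂ u (A f u) =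
        - inner ℂ (u - w) (A f (u + w)) + inner ℂ u (A f w) - inner ℂ w (A f u) := by
      simp only [map_add, inner_sub_left, inner_add_right]; ring
    rw [this]
    have t1 := norm_sub_le (-inner ℂ (u - w) (A f (u + w)) + inner ℂ u (A f w))
      (inner ℂ w (A f u))
    have t2 := norm_add_le (-inner ℂ (u - w) (A f (u + w))) (inner ℂ u (A f w))
    rw [norm_neg] at t2
    set a := ‖inner ℂ (u - w) (A f (u + w))‖
    set b := ‖inner ℂ u (A f w)‖
    set c := ‖inner ℂ w (A f u)‖
    have : ‖-inner ℂ (u - w) (A f (u + w)) + inner ℂ u (A f w) - inner ℂ w (A f u)‖ ^ 2 ≤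
        (a + b + c) ^ 2 := by gcongr; linarith
    nlinarith [sq_nonneg (a - b), sq_nonneg (b - c), sq_nonneg (a - c)]
  calc _ ≤ _ := Finset.sum_le_sum fun f _ => key f
    _ ≤ 18 * B := by
      rw [← Finset.mul_sum, Finset.sum_add_distrib, Finset.sum_add_distrib]; linarith

/-- Operators whose variances are bounded in all pure states are bounded up to multiples of the
identity. -/
lemma sum_norm_sq_sub_smul_le (hB : 0 ≤ B)
    (hA : ∀ φ : E, ‖φ‖ = 1 → ∑ f, ‖orthPart φ (A f φ)‖ ^ 2 ≤ B) {u : E} (hu : ‖u‖ = 1) (x : E) :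
    ∑ f, ‖A f x - inner ℂ u (A f u) • x‖ ^ 2 ≤ 76 * B * ‖x‖ ^ 2 := by
  -- On the complement of `u`, split `A f w` minus the scalar into its orthogonal part and a
  -- difference of diagonal elements; `38 = 2 * 1 + 2 * 18`. Splitting a general `x` along `u` costs
  -- another factor of two, hence 76.
  have hperp : ∀ y : E, inner ℂ u y = 0 →
      ∑ f, ‖A f y - inner ℂ u (A f u) • y‖ ^ 2 ≤ 38 * B * ‖y‖ ^ 2 := by
    intro y hy
    rcases eq_or_ne y 0 with rfl | hy0
    · simp
    have hy' : ‖y‖ ≠ 0 := norm_ne_zero_iff.2 hy0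
    set w : E := ((‖y‖ : ℂ))⁻¹ • y with hw
    have hw1 : ‖w‖ = 1 := by simp [hw, norm_smul, hy']
    have hyw : y = (‖y‖ : ℂ) • w := by
      rw [hw, smul_smul, mul_inv_cancel₀ (by exact_mod_cast hy'), one_smul]
    have huw : inner ℂ u w = 0 := by rw [hw, inner_smul_right, hy, mul_zero]
    have h1 := sum_norm_sq_sub_inner_le hA hu hw1 huw
    have h2 := hA w hw1
    have key : ∀ f, ‖A f y - inner ℂ u (A f u) • y‖ ^ 2 ≤ ‖y‖ ^ 2 *
        (2 * ‖orthPart w (A f w)‖ ^ 2 + 2 * ‖inner ℂ w (A f w) - inner ℂ u (A f u)‖ ^ 2) := by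
      intro f
      have e : A f y - inner ℂ u (A f u) • y = (‖y‖ : ℂ) • (orthPart w (A f w) +
          (inner ℂ w (A f w) - inner ℂ u (A f u)) • w) := by
        conv_lhs => rw [hyw]
        simp only [map_smul, orthPart, smul_add, smul_sub, sub_smul, smul_smul]
        rw [mul_comm (inner ℂ u (A f u)) (‖y‖ : ℂ)]
        abel
      rw [e, norm_smul, mul_pow]
      have : ‖(‖y‖ : ℂ)‖ = ‖y‖ := by simp
      rw [this]
      gcongr
      refine (norm_add_sq_le_two _ _).trans ?_
      rw [norm_smul, hw1, mul_one]
    calc _ ≤ _ := Finset.sum_le_sum fun f _ => key f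
      _ ≤ ‖y‖ ^ 2 * (38 * B) := by
        rw [← Finset.mul_sum, Finset.sum_add_distrib, ← Finset.mul_sum, ← Finset.mul_sum]
        gcongr; linarith
      _ = _ := by ring
  have h1 := hperp _ (inner_orthPart hu x)
  have h2 := hA u hu
  have hx := norm_sq_eq_orthPart hu x
  have key : ∀ f, ‖A f x - inner ℂ u (A f u) • x‖ ^ 2 ≤
      2 * ‖inner ℂ u x‖ ^ 2 * ‖orthPart u (A f u)‖ ^ 2 +
      2 * ‖A f (orthPart u x) - inner ℂ u (A f u) • orthPart u x‖ ^ 2 := by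
    intro f
    have e : A f x - inner ℂ u (A f u) • x = inner ℂ u x • orthPart u (A f u) +
        (A f (orthPart u x) - inner ℂ u (A f u) • orthPart u x) := by
      simp only [orthPart, map_sub, map_smul, smul_sub, smul_smul]
      rw [mul_comm (inner ℂ u (A f u))]
      abel
    rw [e]
    refine (norm_add_sq_le_two _ _).trans ?_
    rw [norm_smul, mul_pow, mul_assoc]
  calc _ ≤ _ := Finset.sum_le_sum fun f _ => key f
    _ ≤ 2 * ‖inner ℂ u x‖ ^ 2 * B + 2 * (38 * B * ‖orthPart u x‖ ^ 2) := by
      rw [Finset.sum_add_distrib, ← Finset.mul_sum, ← Finset.mul_sum]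
      gcongr
    _ ≤ _ := by rw [hx]; nlinarith [mul_nonneg hB (sq_nonneg ‖inner ℂ u x‖)]

end Scalar

/-- The covariance of commuting operators `V`, `W` in a state `t` that is close to the range of
a projection `P` which commutes with `W` and compresses `V` to zero. -/
lemma norm_sum_inner_orthPart_le {V W : ι → E →ₗ[ℂ] E} {P : E →ₗ[ℂ] E} {t : E} {a : ℝ}
    (ha : 0 ≤ a) (ht : ‖t‖ = 1) (hV : ∀ x, ∑ f, ‖V f x‖ ^ 2 ≤ a ^ 2 * ‖x‖ ^ 2)
    (hW : ∀ x, ∑ f, ‖W f x‖ ^ 2 ≤ a ^ 2 * ‖x‖ ^ 2) (hP : P.IsSymmetric)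
    (hP1 : ‖P t‖ ≤ 1) (hPP : P (P t) = P t) (hPV : ∀ f x, P (V f (P x)) = 0)
    (hPW : ∀ f x, W f (P x) = P (W f x)) :
    ‖∑ f, inner ℂ (orthPart t (V f t)) (orthPart t (W f t))‖ ≤ 4 * a ^ 2 * ‖t - P t‖ := by
  set r := t - P t with hr
  have htr : t = r + P t := by simp [hr]
  have hV' : ∀ x, ∑ f, ‖V f x‖ ^ 2 ≤ (a * ‖x‖) ^ 2 := fun x => by rw [mul_pow]; exact hV x
  have hW' : ∀ x, ∑ f, ‖W f x‖ ^ 2 ≤ (a * ‖x‖) ^ 2 := fun x => by rw [mul_pow]; exact hW x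
  set c : ι → ℂ := fun f => inner ℂ t (W f t) with hc
  have hcs : ∑ f, ‖c f‖ ^ 2 ≤ a ^ 2 := by
    refine (Finset.sum_le_sum fun f _ => ?_).trans ((hW t).trans_eq (by rw [ht]; ring))
    gcongr; exact norm_inner_unit_le ht _
  have hcx : ∀ x : E, ∑ f, ‖c f • x‖ ^ 2 ≤ (a * ‖x‖) ^ 2 := fun x => by
    simp only [norm_smul, mul_pow, ← Finset.sum_mul]; gcongr
  -- Every term without a factor `r = t - P t` vanishes: `P` moves through `W` and through the inner
  -- product, and leaves `P V P = 0`. Each of the four remaining terms is at most `a ^ 2 * ‖r‖`.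
  have e : ∀ f, inner ℂ (orthPart t (V f t)) (orthPart t (W f t)) =
      inner ℂ (V f r) (W f t) + inner ℂ (V f (P t)) (W f r) -
        (inner ℂ (V f r) (c f • t) + inner ℂ (V f (P t)) (c f • r)) := by
    intro f
    have e0 : inner ℂ (orthPart t (V f t)) (orthPart t (W f t)) =
        inner ℂ (V f t) (W f t) - inner ℂ (V f t) (c f • t) := by
      conv_lhs => rw [orthPart, inner_sub_left, inner_smul_left, inner_orthPart ht, mul_zero,
        sub_zero, orthPart, inner_sub_right]
    have e1 : inner ℂ (V f (P t)) (P t) = 0 := by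
      rw [← hPP, ← hP, hPP, hPV, inner_zero_left]
    have e2 : inner ℂ (V f (P t)) (W f (P t)) = 0 := by
      rw [hPW, ← hP, hPV, inner_zero_left]
    have e3 : V f t = V f r + V f (P t) := by rw [← map_add, ← htr]
    have e4 : inner ℂ (V f t) (W f t) = inner ℂ (V f r) (W f t) + inner ℂ (V f (P t)) (W f r) := by
      rw [e3, inner_add_left]
      congr 1
      rw [hr, map_sub, inner_sub_right, e2, sub_zero]
    have e5 : inner ℂ (V f t) (c f • t) =
        inner ℂ (V f r) (c f • t) + inner ℂ (V f (P t)) (c f • r) := by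
      rw [e3, inner_add_left]
      congr 1
      rw [hr, smul_sub, inner_sub_right, inner_smul_right _ (P t), e1, mul_zero, sub_zero]
    rw [e0, e4, e5]
  simp only [e, Finset.sum_sub_distrib, Finset.sum_add_distrib]
  have b1 := norm_sum_inner_le (by positivity) (by positivity) (hV' r) (hW' t)
  have b2 := norm_sum_inner_le (by positivity) (by positivity) (hV' (P t)) (hW' r)
  have b3 := norm_sum_inner_le (by positivity) (by positivity) (hV' r) (hcx t)
  have b4 := norm_sum_inner_le (by positivity) (by positivity) (hV' (P t)) (hcx r)
  have h0 : 0 ≤ a ^ 2 * ‖r‖ := by positivity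
  have h1 : a * ‖P t‖ * (a * ‖r‖) ≤ a ^ 2 * ‖r‖ := by nlinarith
  rw [ht] at b1 b3
  refine (norm_sub_le _ _).trans ?_
  refine (add_le_add (norm_add_le _ _) (norm_add_le _ _)).trans ?_
  nlinarith

/-- Orthogonal scattering from a sum of operators on sites that are almost uncorrelated. -/
lemma sum_norm_sq_orthPart_sum_le {κ : Type*} [Fintype κ] [DecidableEq κ]
    {V : κ → ι → E →ₗ[ℂ] E} {P : κ → E →ₗ[ℂ] E} {t : E} {a : ℝ} {s : κ → ℝ}
    (ha : 0 ≤ a) (ht : ‖t‖ = 1) (hV : ∀ k x, ∑ f, ‖V k f x‖ ^ 2 ≤ a ^ 2 * ‖x‖ ^ 2)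
    (hP : ∀ k, (P k).IsSymmetric)
    (hP1 : ∀ k, ‖P k t‖ ≤ 1) (hPP : ∀ k, P k (P k t) = P k t)
    (hPV : ∀ k f x, P k (V k f (P k x)) = 0)
    (hPW : ∀ k l, k ≠ l → ∀ f x, V l f (P k x) = P k (V l f x))
    (hs : ∀ k, ‖t - P k t‖ ^ 2 ≤ s k) :
    ∑ f, ‖orthPart t (∑ k, V k f t)‖ ^ 2 ≤
      4 * a ^ 2 * (Fintype.card κ + Fintype.card κ * ∑ k, √(s k)) := by
  have e : (∑ f, ‖orthPart t (∑ k, V k f t)‖ ^ 2 : ℝ) = RCLike.re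
      (∑ k, ∑ l, ∑ f, inner ℂ (orthPart t (V k f t)) (orthPart t (V l f t))) := by
    have : ∀ k, ∑ l, ∑ f, inner ℂ (orthPart t (V k f t)) (orthPart t (V l f t)) =
        ∑ f, ∑ l, inner ℂ (orthPart t (V k f t)) (orthPart t (V l f t)) :=
      fun k => Finset.sum_comm
    simp only [this]
    rw [Finset.sum_comm, map_sum]
    refine Finset.sum_congr rfl fun f _ => ?_
    rw [← inner_self_eq_norm_sq (𝕜 := ℂ), orthPart_sum, sum_inner]
    simp only [inner_sum]
  -- For a pair of distinct sites the error of `k` alone suffices, so the sum over `l` contributes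
  -- only a factor of the number of sites.
  have hkl : ∀ k l, ‖∑ f, inner ℂ (orthPart t (V k f t)) (orthPart t (V l f t))‖ ≤
      4 * a ^ 2 * ((if k = l then 1 else 0) + √(s k)) := by
    intro k l
    by_cases h : k = l
    · subst h
      have hb : ∑ f, ‖orthPart t (V k f t)‖ ^ 2 ≤ a ^ 2 := by
        refine (Finset.sum_le_sum fun f _ => ?_).trans ((hV k t).trans_eq (by rw [ht]; ring))
        gcongr; exact norm_orthPart_le ht _
      refine (norm_sum_inner_le ha ha hb hb).trans ?_
      rw [if_pos rfl]
      nlinarith [mul_nonneg (sq_nonneg a) (Real.sqrt_nonneg (s k)), sq_nonneg a]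
    · refine (norm_sum_inner_orthPart_le ha ht (hV k) (hV l) (hP k) (hP1 k) (hPP k) (hPV k)
        (hPW k l h)).trans ?_
      rw [if_neg h, zero_add]
      gcongr
      exact Real.le_sqrt_of_sq_le (hs k)
  rw [e]
  refine (RCLike.re_le_norm _).trans ((norm_sum_le _ _).trans ?_)
  calc _ ≤ ∑ k, ∑ l, 4 * a ^ 2 * ((if k = l then 1 else 0) + √(s k)) :=
        Finset.sum_le_sum fun k _ => (norm_sum_le _ _).trans
          (Finset.sum_le_sum fun l _ => hkl k l)
    _ = _ := by
        simp only [← Finset.mul_sum, Finset.sum_add_distrib, Finset.sum_ite_eq, Finset.mem_univ,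
          if_true, Finset.sum_const, Finset.card_univ, nsmul_eq_mul, mul_one]

end Hilbert

/-! ### Matrix expressions as Hilbert space expressions; entropy and the top eigenvalue -/

section Bridge

variable {n : Type} [Fintype n] [DecidableEq n]

lemma dotProduct_eq_inner (x y : n → ℂ) :
    star x ⬝ᵥ y = inner ℂ (WithLp.toLp 2 x) (WithLp.toLp 2 y) := by
  rw [EuclideanSpace.inner_toLp_toLp, dotProduct_comm]

lemma isUnitVec_iff (x : n → ℂ) : IsUnitVec x ↔ ‖(WithLp.toLp 2 x : EuclideanSpace ℂ n)‖ = 1 := by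
  rw [IsUnitVec, dotProduct_eq_inner, inner_self_eq_norm_sq_to_K]
  constructor
  · intro h
    have h0 : ((‖(WithLp.toLp 2 x : EuclideanSpace ℂ n)‖ : ℝ) : ℂ) ^ 2 = 1 := h
    have h' : ‖(WithLp.toLp 2 x : EuclideanSpace ℂ n)‖ ^ 2 = 1 := by exact_mod_cast h0
    exact (pow_eq_one_iff_of_nonneg (norm_nonneg _) two_ne_zero).1 h'
  · intro h; rw [h]; simp

lemma ketbra_mulVec (φ x : n → ℂ) :
    (WithLp.toLp 2 ((ketbra φ).mulVec x) : EuclideanSpace ℂ n) =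
      inner ℂ (WithLp.toLp 2 φ) (WithLp.toLp 2 x : EuclideanSpace ℂ n) • WithLp.toLp 2 φ := by
  rw [← dotProduct_eq_inner, ketbra, Matrix.vecMulVec_mulVec]
  ext a
  simp [mul_comm]

lemma perpProb_eq {m : ℕ} (A : Matrix (Fin m × n) (Fin m × n) ℂ) (i f : Fin m) (t : n → ℂ)
    (ht : IsUnitVec t) :
    perpProb A i f t = ‖orthPart (WithLp.toLp 2 t : EuclideanSpace ℂ n)
      (Matrix.toEuclideanLin (block A f i) (WithLp.toLp 2 t))‖ ^ 2 := by
  have ht' := (isUnitVec_iff t).1 ht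
  set y := (block A f i).mulVec t
  rw [perpProb, dotProduct_eq_inner, Matrix.sub_mulVec, Matrix.one_mulVec, WithLp.toLp_sub,
    ketbra_mulVec]
  change (inner ℂ (WithLp.toLp 2 y)
    (orthPart (WithLp.toLp 2 t : EuclideanSpace ℂ n) (WithLp.toLp 2 y))).re =
    ‖orthPart (WithLp.toLp 2 t : EuclideanSpace ℂ n) (WithLp.toLp 2 y)‖ ^ 2
  set T : EuclideanSpace ℂ n := WithLp.toLp 2 t
  set Y : EuclideanSpace ℂ n := WithLp.toLp 2 y
  have : inner ℂ Y (orthPart T Y) = inner ℂ (orthPart T Y) (orthPart T Y) := by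
    conv_rhs => rw [orthPart, inner_sub_left, inner_smul_left, ← orthPart, inner_orthPart ht',
      mul_zero, sub_zero]
  rw [this, ← inner_self_eq_norm_sq (𝕜 := ℂ)]
  rfl

lemma scatProb_eq {m : ℕ} (A : Matrix (Fin m × n) (Fin m × n) ℂ) (i : Fin m) (t : n → ℂ) :
    scatProb A i t = ∑ f ∈ Finset.univ.erase i,
      ‖Matrix.toEuclideanLin (block A f i) (WithLp.toLp 2 t)‖ ^ 2 := by
  refine Finset.sum_congr rfl fun f _ => ?_
  rw [dotProduct_eq_inner, ← inner_self_eq_norm_sq (𝕜 := ℂ)]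
  rfl

lemma ketbra_apply (φ : n → ℂ) (a b : n) : ketbra φ a b = φ a * star (φ b) := rfl

lemma ketbra_posSemidef (φ : n → ℂ) : (ketbra φ).PosSemidef :=
  Matrix.posSemidef_vecMulVec_self_star φ

/-- The vector is an eigenvector of the largest eigenvalue. Since `-x ln x ≥ x (1 - x)` on `[0, 1]`
and the eigenvalues are weights, `1 - λ_max ≤ ∑ λ (1 - λ) ≤ S`; nonnegativity follows from `λ_max ≤
1`. -/
lemma entropy_bounds {ρ : Matrix n n ℂ} (hρ : IsDensity ρ) :
    0 ≤ entropy ρ ∧ ∃ φ : n → ℂ, IsUnitVec φ ∧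
      1 - (star φ ⬝ᵥ ρ.mulVec φ).re ≤ entropy ρ := by
  obtain ⟨hp, ht⟩ := hρ
  have hH := hp.1
  set ev := hH.eigenvalues with hev
  have h0 : ∀ j, 0 ≤ ev j := hp.eigenvalues_nonneg
  have h1 : ∑ j, ev j = 1 := by
    have h : ((1 : ℝ) : ℂ) = ∑ j, ((ev j : ℝ) : ℂ) := by
      rw [Complex.ofReal_one, ← ht]; exact hH.trace_eq_sum_eigenvalues
    exact_mod_cast h.symm
  have hS : entropy ρ = ∑ j, Real.negMulLog (ev j) := by rw [entropy, dif_pos hH]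
  have hle : ∀ j, ev j * (1 - ev j) ≤ Real.negMulLog (ev j) := by
    intro j
    rcases (h0 j).eq_or_lt with h | h
    · simp [← h]
    · have := Real.log_le_sub_one_of_pos h
      rw [Real.negMulLog]
      nlinarith
  have hne : (Finset.univ : Finset n).Nonempty := by
    by_contra h
    rw [Finset.not_nonempty_iff_eq_empty] at h
    rw [h] at h1
    simp at h1
  obtain ⟨j, -, hj⟩ := Finset.exists_max_image Finset.univ ev hne
  have hj1 : ev j ≤ 1 := by
    rw [← h1]; exact Finset.single_le_sum (fun i _ => h0 i) (Finset.mem_univ j)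
  have hmain : 1 - ev j ≤ entropy ρ := by
    rw [hS]
    calc 1 - ev j = ∑ i, ev i * (1 - ev j) := by rw [← Finset.sum_mul, h1, one_mul]
      _ ≤ ∑ i, ev i * (1 - ev i) := Finset.sum_le_sum fun i hi =>
          mul_le_mul_of_nonneg_left (by linarith [hj i hi]) (h0 i)
      _ ≤ _ := Finset.sum_le_sum fun i _ => hle i
  refine ⟨by linarith, hH.eigenvectorBasis j, ?_, ?_⟩
  · rw [isUnitVec_iff]; exact hH.eigenvectorBasis.norm_eq_one j
  · have := hH.eigenvalues_eq j
    rw [hev] at hmain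
    rw [this] at hmain
    exact hmain

end Bridge

/-! ### Operators on single sites, reduced states and scattering from a pure target state -/

section Sites

variable {N : ℕ} {d : Fin N → ℕ}

/-- An operator on the `k`-th site, extended by the identity on all other sites. -/
def siteMat (k : Fin N) (A : Matrix (Fin (d k)) (Fin (d k)) ℂ) : Matrix (Config d) (Config d) ℂ :=
  open Classical in
  Matrix.of fun x y => if ∀ j, j ≠ k → x j = y j then A (x k) (y k) else 0

/-- `siteMat` as an operator on the Euclidean space of the target. -/
def siteOp (k : Fin N) (A : Matrix (Fin (d k)) (Fin (d k)) ℂ) :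
    EuclideanSpace ℂ (Config d) →ₗ[ℂ] EuclideanSpace ℂ (Config d) :=
  Matrix.toEuclideanLin (siteMat k A)

lemma block_atSite {m : ℕ} (k : Fin N)
    (A : Matrix (Fin m × Fin (d k)) (Fin m × Fin (d k)) ℂ) (f i : Fin m) :
    block (atSite k A) f i = siteMat k (block A f i) := rfl

lemma siteMat_mulVec (k : Fin N) (A : Matrix (Fin (d k)) (Fin (d k)) ℂ) (t : Config d → ℂ)
    (x : Config d) :
    (siteMat k A).mulVec t x = ∑ a, A (x k) a * t (Function.update x k a) := by
  classical
  have h : ∀ y : Config d, (∀ j, j ≠ k → x j = y j) ↔ Function.update x k (y k) = y := by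
    intro y
    constructor
    · intro h; funext j
      by_cases hj : j = k
      · subst hj; simp
      · rw [Function.update_of_ne hj, h j hj]
    · intro h j hj
      rw [← h, Function.update_of_ne hj]
  calc (siteMat k A).mulVec t x
      = ∑ y : Config d, if Function.update x k (y k) = y then A (x k) (y k) * t y else 0 := by
        refine Finset.sum_congr rfl fun y _ => ?_
        simp only [siteMat, Matrix.of_apply, h y, ite_mul, zero_mul]
    _ = ∑ a, A (x k) a * t (Function.update x k a) := by
        rw [← Finset.sum_filter]
        refine Finset.sum_bij' (fun y _ => y k) (fun a _ => Function.update x k a) ?_ ?_ ?_ ?_ ?_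
        · simp
        · simp
        · intro y hy; exact (Finset.mem_filter.1 hy).2
        · simp
        · intro y hy; rw [(Finset.mem_filter.1 hy).2]

lemma siteOp_apply (k : Fin N) (A : Matrix (Fin (d k)) (Fin (d k)) ℂ)
    (t : EuclideanSpace ℂ (Config d)) (x : Config d) :
    siteOp k A t x = ∑ a, A (x k) a * t (Function.update x k a) :=
  siteMat_mulVec k A _ x

/-- The restriction of `t` to the configurations that agree with `x` away from the `k`-th site. -/
def slice (k : Fin N) (x : Config d) :
    EuclideanSpace ℂ (Config d) →ₗ[ℂ] EuclideanSpace ℂ (Fin (d k)) where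
  toFun t := WithLp.toLp 2 fun a => t (Function.update x k a)
  map_add' _ _ := rfl
  map_smul' _ _ := rfl

lemma slice_apply (k : Fin N) (x : Config d) (t : EuclideanSpace ℂ (Config d)) (a : Fin (d k)) :
    slice k x t a = t (Function.update x k a) := rfl

lemma slice_siteOp (k : Fin N) (A : Matrix (Fin (d k)) (Fin (d k)) ℂ) (x : Config d)
    (t : EuclideanSpace ℂ (Config d)) :
    slice k x (siteOp k A t) = Matrix.toEuclideanLin A (slice k x t) := by
  ext a
  rw [slice_apply, siteOp_apply]
  simp only [Function.update_self, Function.update_idem]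
  rfl

lemma slice_ext {k : Fin N} {t u : EuclideanSpace ℂ (Config d)}
    (h : ∀ x, slice k x t = slice k x u) : t = u := by
  ext x
  have := congrArg (fun v : EuclideanSpace ℂ (Fin (d k)) => v (x k)) (h x)
  simpa [slice_apply] using this

/-- Slices are indexed by whole configurations, so the entry at the site itself is redundant and
everything is counted `d k` times. This avoids splitting the configuration space into a site and its
complement. -/
lemma sum_sum_update {M : Type*} [AddCommMonoid M] (k : Fin N) (F : Config d → M) :
    ∑ x, ∑ a, F (Function.update x k a) = d k • ∑ x, F x := by
  -- Exchanging the entry at `k` with the extra label is an involution.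
  let e : Config d × Fin (d k) ≃ Config d × Fin (d k) :=
    { toFun := fun p => (Function.update p.1 k p.2, p.1 k)
      invFun := fun p => (Function.update p.1 k p.2, p.1 k)
      left_inv := fun p => by simp
      right_inv := fun p => by simp }
  calc ∑ x, ∑ a, F (Function.update x k a)
      = ∑ p : Config d × Fin (d k), F (e p).1 := 
          (Fintype.sum_prod_type fun p : Config d × Fin (d k) => F (e p).1).symm
    _ = ∑ p : Config d × Fin (d k), F p.1 := Equiv.sum_comp e fun p => F p.1
    _ = d k • ∑ x, F x := by rw [Fintype.sum_prod_type]; simp [Finset.smul_sum]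

lemma sum_inner_slice (k : Fin N) (t u : EuclideanSpace ℂ (Config d)) :
    ∑ x, inner ℂ (slice k x t) (slice k x u) = d k • inner ℂ t u := by
  simp only [PiLp.inner_apply, slice_apply]
  exact sum_sum_update k fun x => inner ℂ (t x) (u x)

lemma sum_norm_sq_slice (k : Fin N) (t : EuclideanSpace ℂ (Config d)) :
    ∑ x, ‖slice k x t‖ ^ 2 = d k * ‖t‖ ^ 2 := by
  have h := sum_inner_slice k t t
  simp only [inner_self_eq_norm_sq_to_K, nsmul_eq_mul] at h
  have h' : (∑ x, ((‖slice k x t‖ : ℝ) : ℂ) ^ 2) = d k * ((‖t‖ : ℝ) : ℂ) ^ 2 := h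
  exact_mod_cast h'

lemma siteOp_comm {k l : Fin N} (h : k ≠ l) (A : Matrix (Fin (d k)) (Fin (d k)) ℂ)
    (A' : Matrix (Fin (d l)) (Fin (d l)) ℂ) (t : EuclideanSpace ℂ (Config d)) :
    siteOp k A (siteOp l A' t) = siteOp l A' (siteOp k A t) := by
  ext x
  simp only [siteOp_apply, Function.update_of_ne h, Function.update_of_ne h.symm, Finset.mul_sum]
  rw [Finset.sum_comm]
  refine Finset.sum_congr rfl fun a _ => Finset.sum_congr rfl fun b _ => ?_
  rw [Function.update_comm h]
  ring

/-- Bounds for families of operators on one site extend to the whole target. -/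
lemma sum_norm_sq_le_of_slice {ι : Type*} [Fintype ι] {k : Fin N} (hd : 0 < d k) {D : ℝ}
    (x : ι → EuclideanSpace ℂ (Config d)) (t : EuclideanSpace ℂ (Config d))
    (h : ∀ y, ∑ f, ‖slice k y (x f)‖ ^ 2 ≤ D * ‖slice k y t‖ ^ 2) :
    ∑ f, ‖x f‖ ^ 2 ≤ D * ‖t‖ ^ 2 := by
  have h1 : ∑ y, ∑ f, ‖slice k y (x f)‖ ^ 2 ≤ ∑ y, D * ‖slice k y t‖ ^ 2 :=
    Finset.sum_le_sum fun y _ => h y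
  rw [Finset.sum_comm, ← Finset.mul_sum] at h1
  simp only [sum_norm_sq_slice, ← Finset.mul_sum] at h1
  have hd' : (0 : ℝ) < d k := by exact_mod_cast hd
  nlinarith

/-- Exhibits the reduced state as an average of rank-one operators, from which its positivity, trace
and expectation values are read off. -/
lemma smul_reduced_ketbra (k : Fin N) (t : EuclideanSpace ℂ (Config d)) :
    (d k : ℂ) • reduced (ketbra t) k = ∑ x, ketbra (slice k x t) := by
  ext a b
  rw [Matrix.smul_apply, Matrix.sum_apply, smul_eq_mul, ← nsmul_eq_mul]
  rw [reduced, Matrix.of_apply, ← sum_sum_update]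
  refine Finset.sum_congr rfl fun x _ => ?_
  simp [ketbra_apply, slice_apply]

lemma pos_of_norm_eq_one {t : EuclideanSpace ℂ (Config d)} (ht : ‖t‖ = 1) (k : Fin N) :
    0 < d k := by
  have : Nonempty (Config d) := by
    by_contra h
    rw [not_nonempty_iff] at h
    have : t = 0 := Subsingleton.elim _ _
    simp [this] at ht
  obtain ⟨x⟩ := this
  exact (x k).pos

lemma trace_ketbra {n : Type} [Fintype n] [DecidableEq n] (t : EuclideanSpace ℂ n) :
    (ketbra t).trace = (‖t‖ : ℂ) ^ 2 := by
  rw [ketbra, Matrix.trace_vecMulVec, ← EuclideanSpace.inner_eq_star_dotProduct,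
    inner_self_eq_norm_sq_to_K]
  rfl

lemma reduced_isDensity {t : EuclideanSpace ℂ (Config d)} (ht : ‖t‖ = 1) (k : Fin N) :
    IsDensity (reduced (ketbra t) k) := by
  have hd := pos_of_norm_eq_one ht k
  have hd' : (d k : ℂ) ≠ 0 := by exact_mod_cast hd.ne'
  have e : reduced (ketbra t) k = ((d k : ℂ))⁻¹ • ∑ x, ketbra (slice k x t) := by
    rw [← smul_reduced_ketbra, smul_smul, inv_mul_cancel₀ hd', one_smul]
  constructor
  · rw [e]
    refine Matrix.PosSemidef.smul (Matrix.posSemidef_sum _ fun x _ => ketbra_posSemidef _) ?_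
    exact inv_nonneg.2 (by exact_mod_cast hd.le)
  · rw [e, Matrix.trace_smul, Matrix.trace_sum]
    simp only [trace_ketbra]
    have := sum_norm_sq_slice k t
    rw [ht, one_pow, mul_one] at this
    have h2 : (∑ x, ((‖slice k x t‖ : ℂ)) ^ 2) = d k := by exact_mod_cast this
    rw [h2, smul_eq_mul, inv_mul_cancel₀ hd']

lemma dotProduct_reduced (k : Fin N) (t : EuclideanSpace ℂ (Config d))
    (φ : EuclideanSpace ℂ (Fin (d k))) :
    d k * (star φ.ofLp ⬝ᵥ (reduced (ketbra t) k).mulVec φ).re =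
      ∑ x, ‖inner ℂ φ (slice k x t)‖ ^ 2 := by
  have h : (d k : ℂ) * (star φ.ofLp ⬝ᵥ (reduced (ketbra t) k).mulVec φ) =
      ∑ x, (‖inner ℂ φ (slice k x t)‖ : ℂ) ^ 2 := by
    rw [← smul_eq_mul, ← dotProduct_smul, ← Matrix.smul_mulVec, smul_reduced_ketbra,
      Matrix.sum_mulVec, dotProduct_sum]
    refine Finset.sum_congr rfl fun x _ => ?_
    rw [dotProduct_eq_inner, ketbra_mulVec, inner_smul_right]
    change inner ℂ (slice k x t) φ * inner ℂ φ (slice k x t) = _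
    rw [← inner_conj_symm, Complex.conj_mul']
  have := congrArg Complex.re h
  rw [← Complex.ofReal_natCast, Complex.re_ofReal_mul] at this
  rw [this]
  norm_cast

lemma toEuclideanLin_ketbra {n : Type} [Fintype n] [DecidableEq n] (φ x : EuclideanSpace ℂ n) :
    Matrix.toEuclideanLin (ketbra φ) x = inner ℂ φ x • φ := ketbra_mulVec _ _

lemma isSymmetric_siteOp_ketbra (k : Fin N) (φ : EuclideanSpace ℂ (Fin (d k))) (hd : 0 < d k) :
    (siteOp k (ketbra φ)).IsSymmetric := by
  intro t u
  have h : d k • inner ℂ (siteOp k (ketbra φ) t) u = d k • inner ℂ t (siteOp k (ketbra φ) u) := by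
    rw [← sum_inner_slice, ← sum_inner_slice]
    refine Finset.sum_congr rfl fun x _ => ?_
    rw [slice_siteOp, slice_siteOp, toEuclideanLin_ketbra, toEuclideanLin_ketbra,
      inner_smul_left, inner_smul_right, inner_conj_symm, mul_comm]
  exact smul_right_injective _ hd.ne' h

/-- Pythagoras in every slice, summed over the slices. With `φ` a top eigenvector the right side is
the quantity that `entropy_bounds` controls. -/
lemma norm_sq_sub_siteOp_ketbra {t : EuclideanSpace ℂ (Config d)} (ht : ‖t‖ = 1) (k : Fin N)
    {φ : EuclideanSpace ℂ (Fin (d k))} (hφ : ‖φ‖ = 1) :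
    ‖t - siteOp k (ketbra φ) t‖ ^ 2 =
      1 - (star φ.ofLp ⬝ᵥ (reduced (ketbra t) k).mulVec φ).re := by
  have hd : (0 : ℝ) < d k := by exact_mod_cast pos_of_norm_eq_one ht k
  have h1 := sum_norm_sq_slice k (t - siteOp k (ketbra φ) t)
  have h2 := sum_norm_sq_slice k t
  have h3 := dotProduct_reduced k t φ
  have h4 : ∑ x, ‖slice k x t‖ ^ 2 = ∑ x, ‖inner ℂ φ (slice k x t)‖ ^ 2 +
      ∑ x, ‖slice k x (t - siteOp k (ketbra φ) t)‖ ^ 2 := by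
    rw [← Finset.sum_add_distrib]
    refine Finset.sum_congr rfl fun x _ => ?_
    rw [map_sub, slice_siteOp, toEuclideanLin_ketbra]
    exact norm_sq_eq_orthPart hφ _
  rw [ht] at h2
  have : (d k : ℝ) * ‖t - siteOp k (ketbra φ) t‖ ^ 2 =
      d k * (1 - (star φ.ofLp ⬝ᵥ (reduced (ketbra t) k).mulVec φ).re) := by
    linarith
  exact mul_left_cancel₀ hd.ne' this

lemma entropy_reduced_nonneg {t : EuclideanSpace ℂ (Config d)} (ht : ‖t‖ = 1) (k : Fin N) :
    0 ≤ entropy (reduced (ketbra t) k) := (entropy_bounds (reduced_isDensity ht k)).1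

lemma avgEntropy_nonneg {t : EuclideanSpace ℂ (Config d)} (ht : ‖t‖ = 1) : 0 ≤ avgEntropy t.ofLp :=
  div_nonneg (Finset.sum_nonneg fun k _ => entropy_reduced_nonneg ht k) (Nat.cast_nonneg _)

lemma sum_sqrt_entropy_le {t : EuclideanSpace ℂ (Config d)} (ht : ‖t‖ = 1) :
    ∑ k, √(entropy (reduced (ketbra t) k)) ≤ N * √(avgEntropy t.ofLp) := by
  have h := sq_sum_le_card_mul_sum_sq (s := Finset.univ)
    (f := fun k => √(entropy (reduced (ketbra t) k)))
  simp only [Real.sq_sqrt (entropy_reduced_nonneg ht _), Finset.card_univ, Fintype.card_fin] at h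
  rcases Nat.eq_zero_or_pos N with rfl | hN
  · simp
  have hN' : (0 : ℝ) < N := by exact_mod_cast hN
  refine le_of_sq_le_sq (h.trans_eq ?_) (by positivity)
  rw [mul_pow, Real.sq_sqrt (avgEntropy_nonneg ht), avgEntropy]
  field_simp

/-- Orthogonal scattering from a pure state of the target, in terms of the mean entropy of the
sites. -/
theorem sum_norm_sq_orthPart_siteOp_le {ι : Type*} [Fintype ι]
    (M : ∀ k, ι → Matrix (Fin (d k)) (Fin (d k)) ℂ) {B : ℝ} (hB : 0 ≤ B)
    (hM : ∀ k, ∀ φ : EuclideanSpace ℂ (Fin (d k)), ‖φ‖ = 1 →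
      ∑ f, ‖orthPart φ (Matrix.toEuclideanLin (M k f) φ)‖ ^ 2 ≤ B)
    {t : EuclideanSpace ℂ (Config d)} (ht : ‖t‖ = 1) :
    ∑ f, ‖orthPart t (∑ k, siteOp k (M k f) t)‖ ^ 2 ≤
      304 * B * (N + N ^ 2 * √(avgEntropy t.ofLp)) := by
  have hd := pos_of_norm_eq_one ht
  have hφ : ∀ k, ∃ φ : EuclideanSpace ℂ (Fin (d k)), ‖φ‖ = 1 ∧
      ‖t - siteOp k (ketbra φ) t‖ ^ 2 ≤ entropy (reduced (ketbra t) k) := by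
    intro k
    obtain ⟨-, φ, h1, h2⟩ := entropy_bounds (reduced_isDensity ht k)
    rw [isUnitVec_iff] at h1
    exact ⟨WithLp.toLp 2 φ, h1, (norm_sq_sub_siteOp_ketbra ht k h1).trans_le h2⟩
  choose φ hφ1 hφ2 using hφ
  -- Centering at the expectation in `φ k` makes the compression of `V k f` by `P k` vanish. It
  -- costs nothing, since a multiple of `t` has no orthogonal part.
  set c : ∀ k, ι → ℂ := fun k f => inner ℂ (φ k) (Matrix.toEuclideanLin (M k f) (φ k)) with hc
  set V : Fin N → ι → EuclideanSpace ℂ (Config d) →ₗ[ℂ] EuclideanSpace ℂ (Config d) :=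
    fun k f => siteOp k (M k f) - c k f • LinearMap.id with hVdef
  set P : Fin N → EuclideanSpace ℂ (Config d) →ₗ[ℂ] EuclideanSpace ℂ (Config d) :=
    fun k => siteOp k (ketbra (φ k)) with hPdef
  have sV : ∀ k f y x, slice k y (V k f x) =
      Matrix.toEuclideanLin (M k f) (slice k y x) - c k f • slice k y x := by
    intro k f y x
    simp only [hVdef, LinearMap.sub_apply, map_sub, slice_siteOp, LinearMap.smul_apply, map_smul,
      LinearMap.id_apply]
  have sP : ∀ k y x, slice k y (P k x) = inner ℂ (φ k) (slice k y x) • φ k := by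
    intro k y x
    rw [hPdef, slice_siteOp, toEuclideanLin_ketbra]
  have iφ : ∀ k, (inner ℂ (φ k) (φ k) : ℂ) = 1 := fun k => by
    rw [inner_self_eq_norm_sq_to_K, hφ1]; simp
  have hPP : ∀ k x, P k (P k x) = P k x := fun k x => slice_ext (k := k) fun y => by
    rw [sP, sP, inner_smul_right, iφ, mul_one]
  have hPs : ∀ k, (P k).IsSymmetric := fun k => isSymmetric_siteOp_ketbra k _ (hd k)
  have hP1 : ∀ k, ‖P k t‖ ≤ 1 := by
    intro k
    have h1 : ((‖P k t‖ ^ 2 : ℝ) : ℂ) = inner ℂ t (P k t) := by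
      rw [← hPP, ← hPs, hPP]
      push_cast
      exact (inner_self_eq_norm_sq_to_K (𝕜 := ℂ) (P k t)).symm
    have h2 : ‖P k t‖ ^ 2 ≤ ‖P k t‖ := by
      have := norm_inner_unit_le ht (P k t)
      rw [← h1, Complex.norm_real, Real.norm_of_nonneg (sq_nonneg _)] at this
      exact this
    by_contra h
    nlinarith
  -- 76 comes from `sum_norm_sq_sub_smul_le`; the factor 4 in `sum_norm_sq_orthPart_sum_le` turns it
  -- into 304.
  have ha : √(76 * B) ^ 2 = 76 * B := Real.sq_sqrt (by positivity)
  have key := sum_norm_sq_orthPart_sum_le (V := V) (P := P) (t := t) (a := √(76 * B))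
    (s := fun k => entropy (reduced (ketbra t) k)) (Real.sqrt_nonneg _) ht ?_ hPs hP1
    (fun k => hPP k t) ?_ ?_ hφ2
  · have e : ∀ f, orthPart t (∑ k, siteOp k (M k f) t) = orthPart t (∑ k, V k f t) := by
      intro f
      rw [orthPart_sum, orthPart_sum]
      refine Finset.sum_congr rfl fun k _ => ?_
      have : siteOp k (M k f) t = V k f t + c k f • t := by simp [hVdef]
      rw [this, orthPart_add, orthPart_smul, orthPart_self ht, smul_zero, add_zero]
    simp only [e]
    refine key.trans ?_
    rw [ha, Fintype.card_fin]
    have := mul_le_mul_of_nonneg_left (sum_sqrt_entropy_le ht) (Nat.cast_nonneg (α := ℝ) N)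
    have := mul_le_mul_of_nonneg_left this hB
    nlinarith
  · intro k x
    rw [ha]
    refine sum_norm_sq_le_of_slice (hd k) (fun f => V k f x) x fun y => ?_
    simp only [sV]
    exact sum_norm_sq_sub_smul_le hB (hM k) (hφ1 k) _
  · intro k f x
    refine slice_ext (k := k) fun y => ?_
    rw [sP, sV, sP, map_smul, smul_comm, ← smul_sub, inner_smul_right, inner_sub_right,
      inner_smul_right, iφ]
    simp [hc]
  · intro k l hkl f x
    simp only [hVdef, hPdef, LinearMap.sub_apply, map_sub, LinearMap.smul_apply, map_smul,
      LinearMap.id_apply]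
    rw [siteOp_comm hkl.symm]

/-- Scattering to other particle states from a pure state of the target. -/
theorem sum_norm_sq_sum_siteOp_le {ι : Type*} [Fintype ι]
    (M : ∀ k, ι → Matrix (Fin (d k)) (Fin (d k)) ℂ) {B : ℝ} (s : Finset ι)
    (hM : ∀ k, ∀ φ : EuclideanSpace ℂ (Fin (d k)), ‖φ‖ = 1 →
      ∑ f ∈ s, ‖Matrix.toEuclideanLin (M k f) φ‖ ^ 2 ≤ B)
    {t : EuclideanSpace ℂ (Config d)} (ht : ‖t‖ = 1) :
    ∑ f ∈ s, ‖∑ k, siteOp k (M k f) t‖ ^ 2 ≤ N ^ 2 * B := by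
  have hd := pos_of_norm_eq_one ht
  have h1 : ∀ k, ∑ f ∈ s, ‖siteOp k (M k f) t‖ ^ 2 ≤ B := by
    intro k
    rw [← Finset.sum_coe_sort]
    have := sum_norm_sq_le_of_slice (hd k) (fun f : s => siteOp k (M k f) t) t (D := B) fun y => by
        simp only [slice_siteOp]
        rw [Finset.sum_coe_sort s fun f => ‖Matrix.toEuclideanLin (M k f) (slice k y t)‖ ^ 2]
        set v := slice k y t
        rcases eq_or_ne v 0 with hv | hv
        · simp [hv]
        have hv' : ‖v‖ ≠ 0 := norm_ne_zero_iff.2 hv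
        have := hM k (((‖v‖ : ℂ))⁻¹ • v) (by simp [norm_smul, hv'])
        simp only [map_smul, norm_smul, norm_inv, Complex.norm_real, norm_norm, mul_pow,
          ← Finset.mul_sum] at this
        rw [inv_pow, inv_mul_le_iff₀ (by positivity)] at this
        linarith
    simpa [ht] using this
  have h2 : ∀ f, ‖∑ k, siteOp k (M k f) t‖ ^ 2 ≤ N * ∑ k, ‖siteOp k (M k f) t‖ ^ 2 := by
    intro f
    have := sq_sum_le_card_mul_sum_sq (s := Finset.univ) (f := fun k => ‖siteOp k (M k f) t‖)
    rw [Finset.card_univ, Fintype.card_fin] at this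
    refine le_trans ?_ this
    gcongr
    exact norm_sum_le _ _
  calc _ ≤ ∑ f ∈ s, N * ∑ k, ‖siteOp k (M k f) t‖ ^ 2 := Finset.sum_le_sum fun f _ => h2 f
    _ = N * ∑ k, ∑ f ∈ s, ‖siteOp k (M k f) t‖ ^ 2 := by rw [← Finset.mul_sum, Finset.sum_comm]
    _ ≤ N * ∑ k : Fin N, B := by gcongr; exact h1 _
    _ = _ := by simp; ring

end Sites

/-! ### Leading-order behaviour as the expansion parameter tends to zero -/

section Limits

/-- A polynomial of degree at most `n` that approximates a function with a bound of order `n` is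
a monomial. -/
lemma eval_le_of_tendsto {n : ℕ} {q : Polynomial ℝ} {g h : ℝ → ℝ} {b : ℝ} (hq : q.natDegree ≤ n)
    (hgq : (fun β => g β - q.eval β) =O[𝓝[>] 0] fun β : ℝ => β ^ (n + 1))
    (hgh : ∀ β, |g β| ≤ h β) (hb : Tendsto (fun β => h β / β ^ n) (𝓝[>] 0) (𝓝 b))
    {α : ℝ} (hα : 0 < α) : q.eval α ≤ b * α ^ n := by
  have hid : Tendsto (fun β : ℝ => β) (𝓝[>] 0) (𝓝 0) := tendsto_nhdsWithin_of_tendsto_nhds tendsto_id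
  have hpos : ∀ᶠ β : ℝ in 𝓝[>] 0, 0 < β := eventually_mem_nhdsWithin
  have hr : Tendsto (fun β => (g β - q.eval β) / β ^ n) (𝓝[>] 0) (𝓝 0) := by
    have h1 : (fun β : ℝ => β ^ (n + 1)) =o[𝓝[>] 0] fun β : ℝ => β ^ n := by
      rw [isLittleO_iff_tendsto' (by filter_upwards [hpos] with β hβ h0; simp_all)]
      refine hid.congr' ?_
      filter_upwards [hpos] with β hβ
      rw [pow_succ, mul_div_cancel_left₀ _ (pow_pos hβ n).ne']
    exact (hgq.trans_isLittleO h1).tendsto_div_nhds_zero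
  have hle : ∀ᶠ β : ℝ in 𝓝[>] 0, |q.eval β / β ^ n| ≤
      h β / β ^ n + |(g β - q.eval β) / β ^ n| := by
    filter_upwards [hpos] with β hβ
    have h1 := hgh β
    have : q.eval β / β ^ n = g β / β ^ n - (g β - q.eval β) / β ^ n := by ring
    rw [this]
    refine (abs_sub _ _).trans (add_le_add_left ?_ _)
    rw [abs_div, abs_of_pos (pow_pos hβ n)]
    gcongr
  have hlim : Tendsto (fun β => h β / β ^ n + |(g β - q.eval β) / β ^ n|) (𝓝[>] 0) (𝓝 b) := by
    simpa using hb.add hr.abs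
  -- `|q β| / β ^ n` stays bounded, so the coefficients below degree `n` vanish one after the other:
  -- for `k < n` the cofactor of `X ^ k` is a bounded quantity times `β ^ (n - k)`.
  have hdvd : ∀ k ≤ n, Polynomial.X ^ k ∣ q := by
    intro k
    induction k with
    | zero => simp
    | succ k ih =>
      intro hk
      obtain ⟨r, hr⟩ := ih (by omega)
      have h1 : Tendsto (fun β => r.eval β) (𝓝[>] 0) (𝓝 (r.eval 0)) :=
        tendsto_nhdsWithin_of_tendsto_nhds r.continuous.continuousAt
      have h2 : Tendsto (fun β => r.eval β) (𝓝[>] 0) (𝓝 0) := by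
        have h3 : Tendsto (fun β : ℝ => (h β / β ^ n + |(g β - q.eval β) / β ^ n|) *
            β ^ (n - k)) (𝓝[>] 0) (𝓝 0) := by
          have := hlim.mul (hid.pow (n - k))
          rwa [zero_pow (by omega), mul_zero] at this
        refine squeeze_zero_norm' ?_ h3
        filter_upwards [hle, hpos] with β h4 hβ
        have h5 : r.eval β = q.eval β / β ^ n * β ^ (n - k) := by
          have : β ^ n = β ^ k * β ^ (n - k) := by rw [← pow_add]; congr 1; omega
          rw [hr, this]
          simp only [Polynomial.eval_mul, Polynomial.eval_pow, Polynomial.eval_X]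
          field_simp
        rw [h5, Real.norm_eq_abs, abs_mul, abs_of_pos (pow_pos hβ (n - k))]
        gcongr
      have h0 : r.eval 0 = 0 := tendsto_nhds_unique h1 h2
      have hX : Polynomial.X ∣ r := by
        rw [Polynomial.X_dvd_iff, Polynomial.coeff_zero_eq_eval_zero, h0]
      rw [hr, pow_succ]
      exact mul_dvd_mul_left _ hX
  obtain ⟨r, hr⟩ := hdvd n le_rfl
  have hr0 : r.natDegree = 0 := by
    rcases eq_or_ne r 0 with h0 | h0
    · simp [h0]
    · rw [hr, mul_comm, Polynomial.natDegree_mul_X_pow n h0] at hq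
      omega
  obtain ⟨c, rfl⟩ : ∃ c, r = Polynomial.C c := ⟨_, Polynomial.eq_C_of_natDegree_eq_zero hr0⟩
  have hev : ∀ β, q.eval β = c * β ^ n := fun β => by
    rw [hr, Polynomial.eval_mul, Polynomial.eval_pow, Polynomial.eval_X, Polynomial.eval_C, mul_comm]
  have hcb : c ≤ b := by
    refine ge_of_tendsto hlim ?_
    filter_upwards [hle, hpos] with β h1 hβ
    refine le_trans ?_ ((le_abs_self _).trans h1)
    rw [hev, mul_div_assoc, div_self (pow_pos hβ n).ne', mul_one]
  rw [hev]
  gcongr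

variable {ι E : Type*} [Fintype ι] [DecidableEq ι] [NormedAddCommGroup E] [InnerProductSpace ℂ E]

/-- Bound for the change of outcome probabilities when `t` scatters into the components `y`. -/
def scatterBound (t : E) (y : ι → E) : ℝ :=
  ∑ f, (2 * ‖inner ℂ t (y f)‖ * ‖orthPart t (y f)‖ + ‖orthPart t (y f)‖ ^ 2)

variable {t : E} {i : ι} {y : ℝ → ι → E} {m : ι → E}

lemma tendsto_component
    (hy : ∀ f, Tendsto (fun β : ℝ => (β : ℂ)⁻¹ • (y β f - if f = i then t else 0))
      (𝓝[>] 0) (𝓝 (Complex.I • m f))) (f : ι) :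
    Tendsto (fun β => y β f) (𝓝[>] 0) (𝓝 (if f = i then t else 0)) := by
  have h1 : Tendsto (fun β : ℝ => (β : ℂ)) (𝓝[>] 0) (𝓝 0) :=
    tendsto_nhdsWithin_of_tendsto_nhds (by
      have := Complex.continuous_ofReal.tendsto 0
      simpa using this)
  have h2 := (h1.smul (hy f)).add_const (if f = i then t else 0)
  rw [zero_smul, zero_add] at h2
  refine h2.congr' ?_
  filter_upwards [eventually_mem_nhdsWithin] with β (hβ : 0 < β)
  rw [smul_smul, mul_inv_cancel₀ (by exact_mod_cast hβ.ne'), one_smul, sub_add_cancel]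

lemma tendsto_norm_orthPart_div (ht : ‖t‖ = 1)
    (hy : ∀ f, Tendsto (fun β : ℝ => (β : ℂ)⁻¹ • (y β f - if f = i then t else 0))
      (𝓝[>] 0) (𝓝 (Complex.I • m f))) (f : ι) :
    Tendsto (fun β => ‖orthPart t (y β f)‖ / β) (𝓝[>] 0) (𝓝 ‖orthPart t (m f)‖) := by
  have h := (((continuous_orthPart t).tendsto _).comp (hy f)).norm
  rw [orthPart_smul, norm_smul, Complex.norm_I, one_mul] at h
  refine h.congr' ?_
  filter_upwards [eventually_mem_nhdsWithin] with β (hβ : 0 < β)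
  have e : orthPart t (y β f - if f = i then t else 0) = orthPart t (y β f) := by
    rw [sub_eq_add_neg, orthPart_add, ← neg_one_smul ℂ (if f = i then t else 0), orthPart_smul]
    split_ifs
    · rw [orthPart_self ht, smul_zero, add_zero]
    · simp [orthPart]
  rw [Function.comp_apply, orthPart_smul, e, norm_smul, norm_inv, Complex.norm_real,
    Real.norm_of_nonneg hβ.le, div_eq_inv_mul]

lemma tendsto_norm_inner_div
    (hy : ∀ f, Tendsto (fun β : ℝ => (β : ℂ)⁻¹ • (y β f - if f = i then t else 0))
      (𝓝[>] 0) (𝓝 (Complex.I • m f))) {f : ι} (hf : f ≠ i) :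
    Tendsto (fun β => ‖inner ℂ t (y β f)‖ / β) (𝓝[>] 0) (𝓝 ‖inner ℂ t (m f)‖) := by
  have h := (((continuous_const (y := t)).inner (𝕜 := ℂ) continuous_id).tendsto
    (Complex.I • m f)).comp (hy f) |>.norm
  simp only [id, inner_smul_right, norm_mul, Complex.norm_I, one_mul] at h
  refine h.congr' ?_
  filter_upwards [eventually_mem_nhdsWithin] with β (hβ : 0 < β)
  rw [Function.comp_apply, if_neg hf, sub_zero, inner_smul_right, norm_mul, norm_inv,
    Complex.norm_real, Real.norm_of_nonneg hβ.le, div_eq_inv_mul]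

/-- Only `f = i` survives: there the overlap with `t` tends to a unit and the orthogonal part is of
first order, while for `f ≠ i` both factors are of first order. -/
lemma tendsto_scatterBound_div (ht : ‖t‖ = 1)
    (hy : ∀ f, Tendsto (fun β : ℝ => (β : ℂ)⁻¹ • (y β f - if f = i then t else 0))
      (𝓝[>] 0) (𝓝 (Complex.I • m f))) :
    Tendsto (fun β => scatterBound t (y β) / β) (𝓝[>] 0) (𝓝 (2 * ‖orthPart t (m i)‖)) := by
  have key : ∀ f, Tendsto (fun β => 2 * ‖inner ℂ t (y β f)‖ * (‖orthPart t (y β f)‖ / β) +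
      ‖orthPart t (y β f)‖ * (‖orthPart t (y β f)‖ / β)) (𝓝[>] 0)
      (𝓝 (if f = i then 2 * ‖orthPart t (m i)‖ else 0)) := by
    intro f
    have h1 := tendsto_component hy f
    have h2 := tendsto_norm_orthPart_div ht hy f
    have h3 := (((continuous_orthPart t).tendsto _).comp h1).norm
    have h4 := ((((continuous_const (y := t)).inner (𝕜 := ℂ) continuous_id).tendsto _).comp
      h1).norm
    have h5 := ((h4.const_mul 2).mul h2).add (h3.mul h2)
    have e : (if f = i then 2 * ‖orthPart t (m i)‖ else 0) =
        2 * ‖inner ℂ t (if f = i then t else 0)‖ * ‖orthPart t (m f)‖ +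
          ‖orthPart t (if f = i then t else 0)‖ * ‖orthPart t (m f)‖ := by
      by_cases hf : f = i
      · subst hf
        simp [orthPart_self ht, inner_self_eq_norm_sq_to_K, ht]
      · simp [orthPart, hf]
    rw [e]
    exact h5
  have := tendsto_finsetSum Finset.univ fun f _ => key f
  rw [Finset.sum_ite_eq' Finset.univ i] at this
  simp only [Finset.mem_univ, if_true] at this
  refine this.congr fun β => ?_
  rw [scatterBound, Finset.sum_div]
  exact Finset.sum_congr rfl fun f _ => by ring

/-- With the forward term negligible, each other channel contributes products of two first-order
factors, so the coefficients `m f` determine the limit. -/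
lemma tendsto_scatterBound_div_sq (ht : ‖t‖ = 1)
    (hy : ∀ f, Tendsto (fun β : ℝ => (β : ℂ)⁻¹ • (y β f - if f = i then t else 0))
      (𝓝[>] 0) (𝓝 (Complex.I • m f)))
    (hi : Tendsto (fun β => ‖orthPart t (y β i)‖ / β ^ 2) (𝓝[>] 0) (𝓝 0)) :
    Tendsto (fun β => scatterBound t (y β) / β ^ 2) (𝓝[>] 0)
      (𝓝 (∑ f ∈ Finset.univ.erase i,
        (2 * ‖inner ℂ t (m f)‖ * ‖orthPart t (m f)‖ + ‖orthPart t (m f)‖ ^ 2))) := by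
  have h1 : Tendsto (fun β => 2 * ‖inner ℂ t (y β i)‖ * (‖orthPart t (y β i)‖ / β ^ 2) +
      ‖orthPart t (y β i)‖ * (‖orthPart t (y β i)‖ / β ^ 2)) (𝓝[>] 0) (𝓝 0) := by
    have h1 := tendsto_component hy i
    have h3 := (((continuous_orthPart t).tendsto _).comp h1).norm
    have h4 := ((((continuous_const (y := t)).inner (𝕜 := ℂ) continuous_id).tendsto _).comp
      h1).norm
    simpa using ((h4.const_mul 2).mul hi).add (h3.mul hi)
  have h2 : Tendsto (fun β => ∑ f ∈ Finset.univ.erase i,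
      (2 * (‖inner ℂ t (y β f)‖ / β) * (‖orthPart t (y β f)‖ / β) +
        (‖orthPart t (y β f)‖ / β) ^ 2)) (𝓝[>] 0)
      (𝓝 (∑ f ∈ Finset.univ.erase i,
        (2 * ‖inner ℂ t (m f)‖ * ‖orthPart t (m f)‖ + ‖orthPart t (m f)‖ ^ 2))) := by
    refine tendsto_finsetSum _ fun f hf => ?_
    have h5 := tendsto_norm_orthPart_div ht hy f
    exact (((tendsto_norm_inner_div hy (Finset.ne_of_mem_erase hf)).const_mul 2).mul h5).add
      (h5.pow 2)
  have h3 := h1.add h2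
  rw [zero_add] at h3
  refine h3.congr fun β => ?_
  rw [scatterBound, ← Finset.add_sum_erase _ _ (Finset.mem_univ i), add_div, Finset.sum_div]
  congr 1
  · ring
  · exact Finset.sum_congr rfl fun f _ => by ring

end Limits

/-! ### Effects, unitarity and the change of outcome probabilities for mixtures -/

section Channel

variable {n : Type} [Fintype n] [DecidableEq n]

lemma prob_ketbra (E : Matrix n n ℂ) (ψ : n → ℂ) :
    prob E (ketbra ψ) = (star ψ ⬝ᵥ E.mulVec ψ).re := by
  rw [prob, ketbra, Matrix.mul_vecMulVec, Matrix.trace_vecMulVec, dotProduct_comm]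

open scoped MatrixOrder Matrix.Norms.L2Operator in
lemma IsEffect.exists_contraction {E : Matrix n n ℂ} (hE : IsEffect E) :
    ∃ C : EuclideanSpace ℂ n →ₗ[ℂ] EuclideanSpace ℂ n, (∀ x, ‖C x‖ ≤ ‖x‖) ∧
      ∀ ψ : EuclideanSpace ℂ n, prob E (ketbra ψ) = ‖C ψ‖ ^ 2 := by
  obtain ⟨A, hA⟩ : ∃ A : Matrix n n ℂ, E = A.conjTranspose * A := by
    obtain ⟨A, hA⟩ := CStarAlgebra.nonneg_iff_eq_star_mul_self.1 hE.1.nonneg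
    exact ⟨A, hA⟩
  have key : ∀ ψ : EuclideanSpace ℂ n,
      (star ψ.ofLp ⬝ᵥ E.mulVec ψ).re = ‖Matrix.toEuclideanLin A ψ‖ ^ 2 := by
    intro ψ
    rw [hA, ← Matrix.mulVec_mulVec, Matrix.dotProduct_mulVec, Matrix.vecMul_conjTranspose, star_star,
      dotProduct_eq_inner, ← inner_self_eq_norm_sq (𝕜 := ℂ)]
    rfl
  refine ⟨Matrix.toEuclideanLin A, fun x => ?_, fun ψ => by rw [prob_ketbra, key]⟩
  have h1 := (Complex.le_def.1 (hE.2.dotProduct_mulVec_nonneg x.ofLp)).1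
  rw [Matrix.sub_mulVec, dotProduct_sub, Complex.sub_re, key, Matrix.one_mulVec,
    dotProduct_eq_inner] at h1
  have h2 : (inner ℂ x x : ℂ).re = ‖x‖ ^ 2 := inner_self_eq_norm_sq (𝕜 := ℂ) x
  change (0 : ℝ) ≤ (inner ℂ x x : ℂ).re - _ at h1
  rw [h2] at h1
  exact le_of_sq_le_sq (by linarith) (norm_nonneg _)

lemma ketbra_mulVec_eq (A : Matrix n n ℂ) (ψ : n → ℂ) :
    ketbra (A.mulVec ψ) = A * ketbra ψ * A.conjTranspose := by
  rw [ketbra, ketbra, Matrix.mul_vecMulVec, Matrix.vecMulVec_mul, Matrix.star_mulVec]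

lemma sum_block {m : ℕ} {U : Matrix (Fin m × n) (Fin m × n) ℂ}
    (hU : U ∈ Matrix.unitaryGroup (Fin m × n) ℂ) (i : Fin m) :
    ∑ g, (block U g i).conjTranspose * block U g i = 1 := by
  have h := Matrix.mem_unitaryGroup_iff'.1 hU
  ext a b
  have h' := congrFun (congrFun h (i, a)) (i, b)
  rw [Matrix.sum_apply]
  simp only [Matrix.mul_apply, Matrix.star_apply, Fintype.sum_prod_type] at h'
  simp only [Matrix.mul_apply, Matrix.conjTranspose_apply, block, Matrix.of_apply]
  rw [h']
  simp [Matrix.one_apply]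

lemma sum_norm_sq_block {m : ℕ} {U : Matrix (Fin m × n) (Fin m × n) ℂ}
    (hU : U ∈ Matrix.unitaryGroup (Fin m × n) ℂ) (i : Fin m) (t : EuclideanSpace ℂ n) :
    ∑ f, ‖Matrix.toEuclideanLin (block U f i) t‖ ^ 2 = ‖t‖ ^ 2 := by
  have key : ∀ A : Matrix n n ℂ, ‖Matrix.toEuclideanLin A t‖ ^ 2 =
      (star t.ofLp ⬝ᵥ (A.conjTranspose * A).mulVec t).re := by
    intro A
    rw [← Matrix.mulVec_mulVec, Matrix.dotProduct_mulVec, Matrix.vecMul_conjTranspose, star_star,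
      dotProduct_eq_inner, ← inner_self_eq_norm_sq (𝕜 := ℂ)]
    rfl
  simp only [key, ← Complex.re_sum, ← dotProduct_sum, ← Matrix.sum_mulVec, sum_block hU]
  rw [Matrix.one_mulVec, dotProduct_eq_inner, ← inner_self_eq_norm_sq (𝕜 := ℂ)]
  rfl

lemma IsDensity.scatter {m : ℕ} {U : Matrix (Fin m × n) (Fin m × n) ℂ}
    (hU : U ∈ Matrix.unitaryGroup (Fin m × n) ℂ) (i : Fin m) {ρ : Matrix n n ℂ}
    (hρ : IsDensity ρ) : IsDensity (scatter U i ρ) := by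
  constructor
  · exact Matrix.posSemidef_sum _ fun g _ => hρ.1.mul_mul_conjTranspose_same _
  · rw [Scattering.scatter, Matrix.trace_sum]
    have e : ∀ g, (block U g i * ρ * (block U g i).conjTranspose).trace =
        ((block U g i).conjTranspose * block U g i * ρ).trace :=
      fun g => Matrix.trace_mul_cycle _ _ _
    simp only [e]
    rw [← Matrix.trace_sum, ← Finset.sum_mul, sum_block hU, one_mul, hρ.2]

lemma IsDensity.exists_isMixture {ρ : Matrix n n ℂ} (hρ : IsDensity ρ) :
    ∃ (r : ℕ) (p : Fin r → ℝ) (ψ : Fin r → n → ℂ), IsMixture ρ p ψ := by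
  obtain ⟨r, v, hv⟩ := Matrix.posSemidef_iff_eq_sum_vecMulVec.1 hρ.1
  obtain ⟨x⟩ : Nonempty n := by
    by_contra h
    rw [not_nonempty_iff] at h
    have := hρ.2
    simp [Matrix.trace] at this
  set V : Fin r → EuclideanSpace ℂ n := fun j => WithLp.toLp 2 (v j) with hV
  -- Mixtures require unit vectors even at weight zero, so null vectors are replaced by a basis
  -- vector.
  set W : Fin r → EuclideanSpace ℂ n := fun j =>
    if V j = 0 then EuclideanSpace.single x 1 else ((‖V j‖ : ℂ))⁻¹ • V j with hW
  refine ⟨r, fun j => ‖V j‖ ^ 2, fun j => (W j).ofLp, fun j => by positivity, ?_, ?_, ?_⟩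
  · have h := hρ.2
    rw [hv, Matrix.trace_sum] at h
    have h' : ∑ j, ((‖V j‖ : ℝ) : ℂ) ^ 2 = 1 := by
      rw [← h]
      exact Finset.sum_congr rfl fun j _ => (trace_ketbra (V j)).symm
    exact_mod_cast h'
  · intro j
    rw [isUnitVec_iff]
    change ‖W j‖ = 1
    by_cases h : V j = 0
    · simp [hW, h]
    · have : ‖V j‖ ≠ 0 := norm_ne_zero_iff.2 h
      simp [hW, h, norm_smul]
  · rw [hv]
    refine Finset.sum_congr rfl fun j _ => ?_
    by_cases h : V j = 0
    · have : v j = 0 := congrArg WithLp.ofLp h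
      simp [h, this]
    · have h0 : (‖V j‖ : ℂ) ≠ 0 := by exact_mod_cast norm_ne_zero_iff.2 h
      have h1 : (W j).ofLp = ((‖V j‖ : ℂ))⁻¹ • v j := by
        simp only [hW, if_neg h]; rfl
      beta_reduce
      rw [h1, ketbra, star_smul, Matrix.smul_vecMulVec, Matrix.vecMulVec_smul, smul_smul, smul_smul]
      simp only [star_inv₀, Complex.star_def, Complex.conj_ofReal, Complex.ofReal_pow]
      have : (‖V j‖ : ℂ) ^ 2 * ((‖V j‖ : ℂ)⁻¹ * (‖V j‖ : ℂ)⁻¹) = 1 := by field_simp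
      rw [mul_assoc, this, one_smul]

lemma prob_sum (E : Matrix n n ℂ) {r : ℕ} (p : Fin r → ℝ) (σ : Fin r → Matrix n n ℂ) :
    prob E (∑ j, (p j : ℂ) • σ j) = ∑ j, p j * prob E (σ j) := by
  simp only [prob, Finset.mul_sum, Matrix.mul_smul, Matrix.trace_sum, Matrix.trace_smul,
    Complex.re_sum, smul_eq_mul, Complex.re_ofReal_mul]

lemma scatter_sum {m : ℕ} (U : Matrix (Fin m × n) (Fin m × n) ℂ) (i : Fin m) {r : ℕ}
    (p : Fin r → ℝ) (σ : Fin r → Matrix n n ℂ) :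
    scatter U i (∑ j, (p j : ℂ) • σ j) = ∑ j, (p j : ℂ) • scatter U i (σ j) := by
  simp only [scatter, Finset.mul_sum, Finset.sum_mul, Finset.smul_sum, Matrix.mul_smul,
    Matrix.smul_mul]
  exact Finset.sum_comm

lemma prob_scatter_ketbra {m : ℕ} (E : Matrix n n ℂ) (U : Matrix (Fin m × n) (Fin m × n) ℂ)
    (i : Fin m) (ψ : n → ℂ) :
    prob E (scatter U i (ketbra ψ)) = ∑ f, prob E (ketbra ((block U f i).mulVec ψ)) := by
  simp only [scatter, ketbra_mulVec_eq, prob, Finset.mul_sum, Matrix.trace_sum, Complex.re_sum]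

/-- The change of the probability of an outcome by scattering from a mixture of pure states. -/
lemma abs_prob_scatter_sub_le {m : ℕ} {E : Matrix n n ℂ} (hE : IsEffect E)
    {U : Matrix (Fin m × n) (Fin m × n) ℂ} (hU : U ∈ Matrix.unitaryGroup (Fin m × n) ℂ)
    (i : Fin m) {r : ℕ} {ρ : Matrix n n ℂ} {p : Fin r → ℝ} {ψ : Fin r → n → ℂ}
    (h : IsMixture ρ p ψ) :
    |prob E (scatter U i ρ) - prob E ρ| ≤ ∑ j, p j * scatterBound
      (WithLp.toLp 2 (ψ j) : EuclideanSpace ℂ n)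
      (fun f => Matrix.toEuclideanLin (block U f i) (WithLp.toLp 2 (ψ j))) := by
  obtain ⟨hp, -, hψ, rfl⟩ := h
  obtain ⟨C, hC, hEC⟩ := hE.exists_contraction
  rw [scatter_sum, prob_sum, prob_sum, ← Finset.sum_sub_distrib]
  refine (Finset.abs_sum_le_sum_abs _ _).trans (Finset.sum_le_sum fun j _ => ?_)
  rw [← mul_sub, abs_mul, abs_of_nonneg (hp j)]
  refine mul_le_mul_of_nonneg_left ?_ (hp j)
  have ht := (isUnitVec_iff _).1 (hψ j)
  rw [prob_scatter_ketbra]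
  have := abs_sum_norm_sq_sub_le C hC ht
    (fun f => Matrix.toEuclideanLin (block U f i) (WithLp.toLp 2 (ψ j)))
    (by rw [sum_norm_sq_block hU, ht, one_pow])
  simp only [← hEC] at this
  exact this

end Channel

/-! ### First-order expansion of the outgoing components -/

namespace Experiment

variable {N K : ℕ} (X : Experiment N K)

lemma tendsto_S (ℓ : Fin K) :
    Tendsto (fun β : ℝ => (β : ℂ)⁻¹ • (X.S ℓ β - 1)) (𝓝[>] 0)
      (𝓝 (Complex.I • ∑ k, atSite k (X.T ℓ k))) := by
  refine tendsto_pi_nhds.2 fun u => tendsto_pi_nhds.2 fun v => ?_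
  have h1 : (fun β : ℝ => β ^ 2) =o[𝓝[>] 0] fun β : ℝ => β := by
    have := (isLittleO_pow_id (𝕜 := ℝ) (n := 2) (by norm_num)).mono
      (nhdsWithin_le_nhds (s := Set.Ioi (0 : ℝ)))
    exact this
  have h2 := ((X.expansion ℓ u v).trans_isLittleO h1)
  have h3 : Tendsto (fun β : ℝ => (β : ℂ)⁻¹ *
      (X.S ℓ β - (1 + (Complex.I * β) • ∑ k, atSite k (X.T ℓ k))) u v) (𝓝[>] 0) (𝓝 0) := by
    rw [tendsto_zero_iff_norm_tendsto_zero]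
    refine h2.norm_left.tendsto_div_nhds_zero.congr' ?_
    filter_upwards [eventually_mem_nhdsWithin] with β (hβ : 0 < β)
    rw [norm_mul, norm_inv, Complex.norm_real, Real.norm_of_nonneg hβ.le, div_eq_inv_mul]
  have h4 := h3.add_const ((Complex.I • ∑ k, atSite k (X.T ℓ k)) u v)
  rw [zero_add] at h4
  refine h4.congr' ?_
  filter_upwards [eventually_mem_nhdsWithin] with β (hβ : 0 < β)
  have : (β : ℂ) ≠ 0 := by exact_mod_cast hβ.ne'
  simp only [Matrix.sub_apply, Matrix.add_apply, Matrix.smul_apply, smul_eq_mul]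
  field_simp
  ring

/-- The first-order coefficient of the component of the target's state `t` for the outgoing
particle state `f`. -/
def firstOrder (ℓ : Fin K) (t : EuclideanSpace ℂ (Config X.d)) (f : Fin (X.m ℓ)) :
    EuclideanSpace ℂ (Config X.d) :=
  ∑ k, siteOp k (block (X.T ℓ k) f (X.i ℓ)) t

lemma tendsto_block (ℓ : Fin K) (t : EuclideanSpace ℂ (Config X.d)) (f : Fin (X.m ℓ)) :
    Tendsto (fun β : ℝ => (β : ℂ)⁻¹ • (Matrix.toEuclideanLin (block (X.S ℓ β) f (X.i ℓ)) t -
      if f = X.i ℓ then t else 0)) (𝓝[>] 0) (𝓝 (Complex.I • X.firstOrder ℓ t f)) := by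
  have hc : Continuous fun M : Matrix (Fin (X.m ℓ) × Config X.d) (Fin (X.m ℓ) × Config X.d) ℂ =>
      Matrix.toEuclideanLin (block M f (X.i ℓ)) t := by
    refine (PiLp.continuous_toLp 2 _).comp (Continuous.matrix_mulVec ?_ continuous_const)
    exact continuous_matrix fun a b => continuous_apply_apply _ _
  have h := (hc.tendsto _).comp (X.tendsto_S ℓ)
  have e1 : Matrix.toEuclideanLin (block (Complex.I • ∑ k, atSite k (X.T ℓ k)) f (X.i ℓ)) t =
      Complex.I • X.firstOrder ℓ t f := by
    have : block (Complex.I • ∑ k, atSite k (X.T ℓ k)) f (X.i ℓ) =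
        Complex.I • ∑ k, siteMat k (block (X.T ℓ k) f (X.i ℓ)) := by
      simp only [← block_atSite]
      ext a b
      simp [block, Matrix.sum_apply]
    rw [this, map_smul, map_sum, LinearMap.smul_apply, LinearMap.sum_apply]
    rfl
  rw [e1] at h
  refine h.congr fun β => ?_
  have : block ((β : ℂ)⁻¹ • (X.S ℓ β - 1)) f (X.i ℓ) =
      (β : ℂ)⁻¹ • (block (X.S ℓ β) f (X.i ℓ) - if f = X.i ℓ then 1 else 0) := by
    ext a b
    split_ifs with hf <;> simp [block, Matrix.one_apply, hf]
  rw [Function.comp_apply, this, map_smul, map_sub, LinearMap.smul_apply, LinearMap.sub_apply]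
  split_ifs <;> simp [Matrix.toLpLin_apply]

end Experiment

/-! ### Concavity and near-optimal decompositions -/

section Entropy

lemma sum_mul_sqrt_le {r : ℕ} {p x : Fin r → ℝ} (hp : ∀ j, 0 ≤ p j) (hp1 : ∑ j, p j = 1)
    (hx : ∀ j, 0 ≤ x j) : ∑ j, p j * √(x j) ≤ √(∑ j, p j * x j) := by
  have := Real.strictConcaveOn_sqrt.concaveOn.le_map_sum (t := Finset.univ) (w := p) (p := x)
    (fun j _ => hp j) hp1 (fun j _ => hx j)
  simpa using this

/-- Jensen twice, for the outer and then for the inner square root. -/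
lemma sum_mul_sqrt_sqrt_le {r : ℕ} {p e : Fin r → ℝ} (hp : ∀ j, 0 ≤ p j) (hp1 : ∑ j, p j = 1)
    (he : ∀ j, 0 ≤ e j) {a : ℝ} (ha : 0 ≤ a) :
    ∑ j, p j * √(a + a ^ 2 * √(e j)) ≤ √(a + a ^ 2 * √(∑ j, p j * e j)) := by
  refine (sum_mul_sqrt_le hp hp1 fun j => by positivity).trans (Real.sqrt_le_sqrt ?_)
  have h := sum_mul_sqrt_le hp hp1 he
  have : ∑ j, p j * (a + a ^ 2 * √(e j)) = a + a ^ 2 * ∑ j, p j * √(e j) := by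
    simp only [mul_add, Finset.sum_add_distrib, ← Finset.sum_mul, hp1, one_mul, Finset.mul_sum]
    congr 1
    exact Finset.sum_congr rfl fun j _ => by ring
  rw [this]
  gcongr

variable {N : ℕ} {d : Fin N → ℕ} {ρ : Matrix (Config d) (Config d) ℂ}

lemma IsMixture.avgEntropy_nonneg {r : ℕ} {p : Fin r → ℝ} {ψ : Fin r → Config d → ℂ}
    (h : IsMixture ρ p ψ) (j : Fin r) : 0 ≤ avgEntropy (ψ j) :=
  Scattering.avgEntropy_nonneg ((isUnitVec_iff _).1 (h.2.2.1 j))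

lemma EMF_nonneg (ρ : Matrix (Config d) (Config d) ℂ) : 0 ≤ EMF ρ := by
  refine Real.sInf_nonneg ?_
  rintro _ ⟨r, p, ψ, h, rfl⟩
  exact Finset.sum_nonneg fun j _ => mul_nonneg (h.1 j) (h.avgEntropy_nonneg j)

lemma IsDensity.exists_meanEntropy_lt (hρ : IsDensity ρ) {δ : ℝ} (hδ : 0 < δ) :
    ∃ (r : ℕ) (p : Fin r → ℝ) (ψ : Fin r → Config d → ℂ),
      IsMixture ρ p ψ ∧ meanEntropy p ψ < EMF ρ + δ := by
  obtain ⟨r, p, ψ, h⟩ := hρ.exists_isMixture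
  have hne : {e | ∃ (r : ℕ) (p : Fin r → ℝ) (ψ : Fin r → Config d → ℂ),
      IsMixture ρ p ψ ∧ e = meanEntropy p ψ}.Nonempty := ⟨_, r, p, ψ, h, rfl⟩
  obtain ⟨_, ⟨r, p, ψ, h, rfl⟩, hlt⟩ := exists_lt_of_csInf_lt hne
    (show EMF ρ < EMF ρ + δ by linarith)
  exact ⟨r, p, ψ, h, hlt⟩

end Entropy

/-! ### Bounds on the contribution of one particle -/

namespace Experiment

variable {N K : ℕ} (X : Experiment N K)

lemma state_isDensity (α : ℝ) (ℓ : Fin (K + 1)) : IsDensity (X.state α ℓ) := by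
  induction ℓ using Fin.induction with
  | zero => exact X.isDensity
  | succ ℓ ih => exact ih.scatter (X.isUnitary ℓ α) (X.i ℓ)

lemma EMF_le_EMFmax (α : ℝ) (ℓ : Fin (K + 1)) : EMF (X.state α ℓ) ≤ X.EMFmax α :=
  le_ciSup (f := fun ℓ => EMF (X.state α ℓ)) (Set.finite_range _).bddAbove ℓ

lemma EMFmax_nonneg (α : ℝ) : 0 ≤ X.EMFmax α := (EMF_nonneg _).trans (X.EMF_le_EMFmax α 0)

variable {X}

lemma sum_norm_sq_orthPart_firstOrder_le {B : ℝ} (hB : 0 ≤ B) (hX : X.PerpBounded B) (ℓ : Fin K)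
    {t : EuclideanSpace ℂ (Config X.d)} (ht : ‖t‖ = 1) :
    ∑ f, ‖orthPart t (X.firstOrder ℓ t f)‖ ^ 2 ≤
      304 * B * (N + N ^ 2 * √(avgEntropy t.ofLp)) := by
  refine sum_norm_sq_orthPart_siteOp_le (fun k f => block (X.T ℓ k) f (X.i ℓ)) hB ?_ ht
  intro k φ hφ
  have hφ' : IsUnitVec φ.ofLp := (isUnitVec_iff _).2 hφ
  have := hX ℓ k φ.ofLp hφ'
  simp only [perpProb_eq _ _ _ _ hφ'] at this
  exact this

lemma sum_norm_sq_firstOrder_le {B : ℝ} (hX : X.ScatBounded B) (ℓ : Fin K)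
    {t : EuclideanSpace ℂ (Config X.d)} (ht : ‖t‖ = 1) :
    ∑ f ∈ Finset.univ.erase (X.i ℓ), ‖X.firstOrder ℓ t f‖ ^ 2 ≤ N ^ 2 * B := by
  refine sum_norm_sq_sum_siteOp_le (fun k f => block (X.T ℓ k) f (X.i ℓ)) _ ?_ ht
  intro k φ hφ
  have := hX ℓ k φ.ofLp ((isUnitVec_iff _).2 hφ)
  rw [scatProb_eq] at this
  exact this

/-- The components of the scattered target in the outgoing particle states. -/
def outgoing (X : Experiment N K) (ℓ : Fin K) (t : EuclideanSpace ℂ (Config X.d)) (β : ℝ)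
    (f : Fin (X.m ℓ)) : EuclideanSpace ℂ (Config X.d) :=
  Matrix.toEuclideanLin (block (X.S ℓ β) f (X.i ℓ)) t

lemma eval_le_of_isMixture {E σ : Matrix (Config X.d) (Config X.d) ℂ} (hE : IsEffect E)
    {ℓ : Fin K} {n : ℕ} {q : Polynomial ℝ} (hq : q.natDegree ≤ n)
    (hgq : (fun β : ℝ => X.gain E σ ℓ β - q.eval β) =O[𝓝[>] 0] fun β : ℝ => β ^ (n + 1))
    {r : ℕ} {p : Fin r → ℝ} {ψ : Fin r → Config X.d → ℂ} (h : IsMixture σ p ψ)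
    {b : Fin r → ℝ} (hb : ∀ j, 0 < p j → Tendsto (fun β =>
      scatterBound (WithLp.toLp 2 (ψ j)) (X.outgoing ℓ (WithLp.toLp 2 (ψ j)) β) / β ^ n)
      (𝓝[>] 0) (𝓝 (b j))) {α : ℝ} (hα : 0 < α) :
    q.eval α ≤ (∑ j, p j * b j) * α ^ n := by
  refine eval_le_of_tendsto hq hgq
    (fun β => abs_prob_scatter_sub_le hE (X.isUnitary ℓ β) (X.i ℓ) h) ?_ hα
  simp only [Finset.sum_div, mul_div_assoc]
  refine tendsto_finsetSum _ fun j _ => ?_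
  -- Components of weight zero satisfy no limit hypothesis, but they drop out of the sum.
  rcases (h.1 j).eq_or_lt with h0 | h0
  · simp [← h0]
  · exact (hb j h0).const_mul _

lemma eval_one_le {E : Matrix (Config X.d) (Config X.d) ℂ} (hE : IsEffect E) {B : ℝ} (hB : 0 ≤ B)
    (hX : X.PerpBounded B) {α : ℝ} (hα : 0 < α) {ℓ : Fin K} {q : Polynomial ℝ}
    (hq : q.natDegree ≤ 1)
    (hgq : (fun β : ℝ => X.gain E (X.state α ℓ.castSucc) ℓ β - q.eval β)
      =O[𝓝[>] 0] fun β : ℝ => β ^ (1 + 1)) :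
    q.eval α ≤ 2 * √(304 * B) * √(N + N ^ 2 * √(X.EMFmax α)) * α := by
  -- `EMF` is an infimum; a decomposition within `δ` of it suffices, because `q` does not depend on
  -- the decomposition and `δ` can then tend to zero.
  have key : ∀ δ > 0, q.eval α ≤ 2 * √(304 * B) * √(N + N ^ 2 * √(X.EMFmax α + δ)) * α := by
    intro δ hδ
    obtain ⟨r, p, ψ, h, hlt⟩ := (X.state_isDensity α ℓ.castSucc).exists_meanEntropy_lt hδ
    have ht := fun j => (isUnitVec_iff _).1 (h.2.2.1 j)
    have h1 := eval_le_of_isMixture hE hq hgq h (b := fun j => 2 * ‖orthPart (WithLp.toLp 2 (ψ j))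
      (X.firstOrder ℓ (WithLp.toLp 2 (ψ j)) (X.i ℓ))‖) (fun j _ => by
        simp only [pow_one]
        exact tendsto_scatterBound_div (ht j) (X.tendsto_block ℓ _)) hα
    rw [pow_one] at h1
    refine h1.trans ?_
    gcongr
    calc _ ≤ ∑ j, 2 * √(304 * B) * (p j * √(N + N ^ 2 * √(avgEntropy (ψ j)))) := by
          refine Finset.sum_le_sum fun j _ => ?_
          have h2 := (Finset.single_le_sum (f := fun f => ‖orthPart (WithLp.toLp 2 (ψ j))
            (X.firstOrder ℓ (WithLp.toLp 2 (ψ j)) f)‖ ^ 2) (fun f _ => sq_nonneg _)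
            (Finset.mem_univ (X.i ℓ))).trans
            (sum_norm_sq_orthPart_firstOrder_le hB hX ℓ (ht j))
          have h3 := Real.le_sqrt_of_sq_le h2
          rw [Real.sqrt_mul (by positivity)] at h3
          nlinarith [h.1 j]
      _ = 2 * √(304 * B) * ∑ j, p j * √(N + N ^ 2 * √(avgEntropy (ψ j))) := by
          rw [Finset.mul_sum]
      _ ≤ _ := by
          gcongr
          refine (sum_mul_sqrt_sqrt_le h.1 h.2.1 h.avgEntropy_nonneg (Nat.cast_nonneg N)).trans ?_
          gcongr
          exact hlt.le.trans (by gcongr; exact X.EMF_le_EMFmax α _)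
  have hc : Continuous fun δ : ℝ =>
      2 * √(304 * B) * √(N + N ^ 2 * √(X.EMFmax α + δ)) * α := by fun_prop
  have hl := tendsto_nhdsWithin_of_tendsto_nhds (s := Set.Ioi 0) (hc.tendsto 0)
  rw [add_zero] at hl
  exact ge_of_tendsto hl (eventually_mem_nhdsWithin.mono key)

lemma tendsto_orthPart_of_perpProb {ℓ : Fin K} {ψ : Config X.d → ℂ} (hψ : IsUnitVec ψ)
    (h : (fun β : ℝ => perpProb (X.S ℓ β) (X.i ℓ) (X.i ℓ) ψ) =O[𝓝[>] 0] fun β : ℝ => β ^ 6) :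
    Tendsto (fun β => ‖orthPart (WithLp.toLp 2 ψ) (X.outgoing ℓ (WithLp.toLp 2 ψ) β (X.i ℓ))‖ /
      β ^ 2) (𝓝[>] 0) (𝓝 0) := by
  have h1 : (fun β : ℝ => β ^ 6) =o[𝓝[>] 0] fun β : ℝ => β ^ 4 :=
    (isLittleO_pow_pow (by norm_num : 4 < 6)).mono nhdsWithin_le_nhds
  have h2 := (h.trans_isLittleO h1).tendsto_div_nhds_zero.sqrt
  rw [Real.sqrt_zero] at h2
  refine h2.congr fun β => ?_
  rw [perpProb_eq _ _ _ _ hψ, Real.sqrt_div (sq_nonneg _), Real.sqrt_sq (norm_nonneg _)]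
  have : β ^ 4 = (β ^ 2) ^ 2 := by ring
  rw [this, Real.sqrt_sq (sq_nonneg _)]
  rfl

/-- The forward orthogonal part is `o(β ^ 2)`, so its first-order coefficient, which alone bounds
the first-order gain, is zero. -/
lemma eval_one_nonpos {E : Matrix (Config X.d) (Config X.d) ℂ} (hE : IsEffect E) {α : ℝ}
    (hα : 0 < α) (hI : X.ForwardInert α) {ℓ : Fin K} {q : Polynomial ℝ} (hq : q.natDegree ≤ 1)
    (hgq : (fun β : ℝ => X.gain E (X.state α ℓ.castSucc) ℓ β - q.eval β)
      =O[𝓝[>] 0] fun β : ℝ => β ^ (1 + 1)) : q.eval α ≤ 0 := by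
  obtain ⟨r, p, ψ, h, -, hperp⟩ := hI ℓ
  have ht := fun j => (isUnitVec_iff _).1 (h.2.2.1 j)
  have h1 := eval_le_of_isMixture hE hq hgq h (b := fun _ => 0) (fun j hj => by
    have h2 := tendsto_scatterBound_div (ht j) (X.tendsto_block ℓ _)
    have h3 := tendsto_norm_orthPart_div (ht j) (X.tendsto_block ℓ _) (X.i ℓ)
    have h4 := (tendsto_orthPart_of_perpProb (h.2.2.1 j) (hperp j hj)).mul
      (tendsto_nhdsWithin_of_tendsto_nhds tendsto_id)
    have h5 : ‖orthPart (WithLp.toLp 2 (ψ j))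
        (X.firstOrder ℓ (WithLp.toLp 2 (ψ j)) (X.i ℓ))‖ = 0 := by
      refine tendsto_nhds_unique h3 ?_
      rw [mul_zero] at h4
      refine h4.congr' ?_
      filter_upwards [eventually_mem_nhdsWithin] with β (hβ : 0 < β)
      simp only [id]
      field_simp
      rfl
    rw [h5, mul_zero] at h2
    simp only [pow_one]
    exact h2) hα
  simpa using h1

lemma eval_two_le {E : Matrix (Config X.d) (Config X.d) ℂ} (hE : IsEffect E) {B : ℝ} (hB : 0 ≤ B)
    (hX : X.PerpBounded B) (hS : X.ScatBounded B) {α : ℝ} (hα : 0 < α) (hI : X.ForwardInert α)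
    {ℓ : Fin K} {q : Polynomial ℝ} (hq : q.natDegree ≤ 2)
    (hgq : (fun β : ℝ => X.gain E (X.state α ℓ.castSucc) ℓ β - q.eval β)
      =O[𝓝[>] 0] fun β : ℝ => β ^ (2 + 1)) :
    q.eval α ≤ 3 * √B * √(304 * B) * (N * √(N + N ^ 2 * √(X.EMFmax α))) * α ^ 2 := by
  obtain ⟨r, p, ψ, h, hmean, hperp⟩ := hI ℓ
  have ht := fun j => (isUnitVec_iff _).1 (h.2.2.1 j)
  have h1 := eval_le_of_isMixture hE hq hgq h (fun j hj =>
    tendsto_scatterBound_div_sq (ht j) (X.tendsto_block ℓ _)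
      (tendsto_orthPart_of_perpProb (h.2.2.1 j) (hperp j hj))) hα
  refine h1.trans ?_
  gcongr
  calc _ ≤ ∑ j, 3 * √B * √(304 * B) * N * (p j * √(N + N ^ 2 * √(avgEntropy (ψ j)))) := by
        refine Finset.sum_le_sum fun j _ => ?_
        set t : EuclideanSpace ℂ (Config X.d) := WithLp.toLp 2 (ψ j) with htd
        -- Both the component along `t` and the orthogonal part are at most the full norm; `3 = 2 +
        -- 1`. One orthogonal factor is kept for Cauchy–Schwarz, since it carries the entropy bound.
        have h2 : ∑ f ∈ Finset.univ.erase (X.i ℓ),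
            (2 * ‖inner ℂ t (X.firstOrder ℓ t f)‖ * ‖orthPart t (X.firstOrder ℓ t f)‖ +
              ‖orthPart t (X.firstOrder ℓ t f)‖ ^ 2) ≤ 3 * ∑ f ∈ Finset.univ.erase (X.i ℓ),
            ‖X.firstOrder ℓ t f‖ * ‖orthPart t (X.firstOrder ℓ t f)‖ := by
          rw [Finset.mul_sum]
          refine Finset.sum_le_sum fun f _ => ?_
          have a1 := norm_inner_unit_le (ht j) (X.firstOrder ℓ t f)
          have a2 := norm_orthPart_le (ht j) (X.firstOrder ℓ t f)
          rw [← htd] at a1 a2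
          nlinarith [norm_nonneg (orthPart t (X.firstOrder ℓ t f))]
        have h3 := Real.sum_mul_le_sqrt_mul_sqrt (Finset.univ.erase (X.i ℓ))
          (fun f => ‖X.firstOrder ℓ t f‖) (fun f => ‖orthPart t (X.firstOrder ℓ t f)‖)
        have h4 : √(∑ f ∈ Finset.univ.erase (X.i ℓ), ‖X.firstOrder ℓ t f‖ ^ 2) ≤ N * √B := by
          refine (Real.sqrt_le_sqrt (sum_norm_sq_firstOrder_le hS ℓ (ht j))).trans_eq ?_
          rw [Real.sqrt_mul (sq_nonneg _), Real.sqrt_sq (Nat.cast_nonneg N)]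
        have h5 : √(∑ f ∈ Finset.univ.erase (X.i ℓ), ‖orthPart t (X.firstOrder ℓ t f)‖ ^ 2) ≤
            √(304 * B) * √(N + N ^ 2 * √(avgEntropy (ψ j))) := by
          rw [← Real.sqrt_mul (by positivity)]
          refine Real.sqrt_le_sqrt (le_trans ?_ (sum_norm_sq_orthPart_firstOrder_le hB hX ℓ (ht j)))
          exact Finset.sum_le_sum_of_subset_of_nonneg (Finset.erase_subset _ _)
            fun f _ _ => sq_nonneg _
        have h6 := h2.trans (mul_le_mul_of_nonneg_left (h3.trans
          (mul_le_mul h4 h5 (Real.sqrt_nonneg _) (by positivity))) (by norm_num : (0 : ℝ) ≤ 3))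
        refine (mul_le_mul_of_nonneg_left h6 (h.1 j)).trans_eq ?_
        ring
    _ = 3 * √B * √(304 * B) * N * ∑ j, p j * √(N + N ^ 2 * √(avgEntropy (ψ j))) := by
        rw [Finset.mul_sum]
    _ ≤ 3 * √B * √(304 * B) * N * √(N + N ^ 2 * √(X.EMFmax α)) := by
        gcongr
        refine (sum_mul_sqrt_sqrt_le h.1 h.2.1 h.avgEntropy_nonneg (Nat.cast_nonneg N)).trans ?_
        gcongr
        exact hmean.trans_le (X.EMF_le_EMFmax α _)
    _ = _ := by ring

lemma DetectsAtOrder.le_mul {n : ℕ} {π ε α b : ℝ} (h : X.DetectsAtOrder n π ε α)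
    (hb : ∀ (E : Matrix (Config X.d) (Config X.d) ℂ) (ℓ : Fin K) (q : Polynomial ℝ), IsEffect E →
      q.natDegree ≤ n → ((fun β : ℝ => X.gain E (X.state α ℓ.castSucc) ℓ β - q.eval β)
        =O[𝓝[>] 0] fun β : ℝ => β ^ (n + 1)) → q.eval α ≤ b) : π - ε ≤ K * b := by
  obtain ⟨E, q, hE, h1, h2, h3⟩ := h
  have h4 : ∑ ℓ, (q ℓ).eval α ≤ ∑ ℓ : Fin K, b :=
    Finset.sum_le_sum fun ℓ _ => hb E ℓ (q ℓ) hE (h2 ℓ).1 (h2 ℓ).2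
  simp at h4
  linarith

end Experiment

/-! ### Assembly of the detection limits -/

lemma mul_sqrt_add_sq_mul_sqrt_le (N : ℕ) {e : ℝ} (he : 0 ≤ e) :
    N * √(N + N ^ 2 * √e) ≤ (N : ℝ) ^ (3 / 2 : ℝ) + (N : ℝ) ^ 2 * e ^ (1 / 4 : ℝ) := by
  have hN : (0 : ℝ) ≤ N := Nat.cast_nonneg N
  have e1 : (N : ℝ) ^ (3 / 2 : ℝ) = N * √N := by
    rw [show (3 / 2 : ℝ) = 1 + 1 / 2 by norm_num, Real.rpow_add' hN (by norm_num), Real.rpow_one,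
      Real.sqrt_eq_rpow]
  have e2 : e ^ (1 / 4 : ℝ) = √(√e) := by
    rw [Real.sqrt_eq_rpow, Real.sqrt_eq_rpow, ← Real.rpow_mul he]; norm_num
  have h : √(N + N ^ 2 * √e) ≤ √N + N * √(√e) := by
    refine Real.sqrt_le_iff.2 ⟨by positivity, ?_⟩
    have h1 := Real.sq_sqrt hN
    have h2 := Real.sq_sqrt (Real.sqrt_nonneg e)
    have h3 : 0 ≤ √(N : ℝ) * (N * √(√e)) := by positivity
    calc (N + N ^ 2 * √e : ℝ) = √N ^ 2 + N ^ 2 * √(√e) ^ 2 := by rw [h1, h2]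
      _ ≤ _ := by nlinarith
  rw [e1, e2]
  nlinarith

end Scattering

end

theorem mainTheorem4 (π ε B : ℝ) (hπ : ε < π) :
    ∃ C : ℝ, ∀ (N K : ℕ) (X : Scattering.Experiment N K), X.PerpBounded B →
      ∀ α : ℝ, 0 < α →
        (X.DetectsAtOrder 1 π ε α →
          1 / α ^ 2 ≤ C * ((K : ℝ) ^ 2 * N + (K : ℝ) ^ 2 * (N : ℝ) ^ 2 * √(X.EMFmax α))) ∧
        (X.ForwardInert α →
          ¬ X.DetectsAtOrder 1 π ε α ∧
          (X.ScatBounded B → X.DetectsAtOrder 2 π ε α →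
            1 / α ^ 2 ≤ C * ((K : ℝ) * (N : ℝ) ^ (3 / 2 : ℝ) +
              (K : ℝ) * (N : ℝ) ^ 2 * (X.EMFmax α) ^ (1 / 4 : ℝ)))) := by
  -- The one-particle estimates need a nonnegative bound, while `B` is an arbitrary real number.
  set b := max B 0 with hb
  have hb0 : 0 ≤ b := le_max_right _ _
  have hd : 0 < π - ε := by linarith
  -- One summand for each order of detection. The first comes from squaring `π - ε ≤ K * (2 * √(304
  -- * b) * …) * α`, with `1216 = 4 * 304`; the second-order inequality is already linear in `α ^
  -- 2`.
  refine ⟨1216 * b / (π - ε) ^ 2 + 3 * √b * √(304 * b) / (π - ε), fun N K X hX α hα => ?_⟩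
  have hXb : X.PerpBounded b := fun ℓ k φ hφ => (hX ℓ k φ hφ).trans (le_max_left _ _)
  have hE := X.EMFmax_nonneg α
  refine ⟨fun h => ?_, fun hI => ⟨fun h => ?_, fun hS h => ?_⟩⟩
  · have h1 := h.le_mul fun E ℓ q hE hq hgq =>
      Scattering.Experiment.eval_one_le hE hb0 hXb hα hq hgq
    have h2 : (π - ε) ^ 2 ≤ 1216 * b * α ^ 2 *
        ((K : ℝ) ^ 2 * N + (K : ℝ) ^ 2 * (N : ℝ) ^ 2 * √(X.EMFmax α)) := by
      refine (pow_le_pow_left₀ hd.le h1 2).trans_eq ?_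
      simp only [mul_pow]
      rw [Real.sq_sqrt (by positivity), Real.sq_sqrt (by positivity)]
      ring
    calc 1 / α ^ 2 ≤ 1216 * b / (π - ε) ^ 2 *
          ((K : ℝ) ^ 2 * N + (K : ℝ) ^ 2 * (N : ℝ) ^ 2 * √(X.EMFmax α)) := by
          rw [div_mul_eq_mul_div, div_le_div_iff₀ (by positivity) (by positivity)]
          linarith
      _ ≤ _ := by gcongr; exact le_add_of_nonneg_right (by positivity)
  · have h1 := h.le_mul (b := 0) fun E ℓ q hE hq hgq =>
      Scattering.Experiment.eval_one_nonpos hE hα hI hq hgq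
    linarith
  · have hSb : X.ScatBounded b := fun ℓ k φ hφ => (hS ℓ k φ hφ).trans (le_max_left _ _)
    have h1 := h.le_mul fun E ℓ q hE hq hgq =>
      Scattering.Experiment.eval_two_le hE hb0 hXb hSb hα hI hq hgq
    have h2 := Scattering.mul_sqrt_add_sq_mul_sqrt_le N hE
    have h3 : π - ε ≤ 3 * √b * √(304 * b) * α ^ 2 * ((K : ℝ) * (N : ℝ) ^ (3 / 2 : ℝ) +
        (K : ℝ) * (N : ℝ) ^ 2 * (X.EMFmax α) ^ (1 / 4 : ℝ)) := by
      have h4 := mul_le_mul_of_nonneg_left h2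
        (show 0 ≤ 3 * √b * √(304 * b) * α ^ 2 * K by positivity)
      linarith
    calc 1 / α ^ 2 ≤ 3 * √b * √(304 * b) / (π - ε) * ((K : ℝ) * (N : ℝ) ^ (3 / 2 : ℝ) +
          (K : ℝ) * (N : ℝ) ^ 2 * (X.EMFmax α) ^ (1 / 4 : ℝ)) := by
          rw [div_mul_eq_mul_div, div_le_div_iff₀ (by positivity) hd]
          linarith
      _ ≤ _ := by gcongr; exact le_add_of_nonneg_left (by positivity)
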